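/- Let $I=[0,1]$ and let $\mathrm{PLo}(I)$ be the group of orientation-preserving piecewise linear homeomorphisms of $I$ with finitely many breakpoints, acting on $I$ from the right, with $[f,g]=f^{-1}g^{-1}fg$. An \emph{orbital} of $f\in\mathrm{PLo}(I)$ is a maximal nonempty interval contained in $\{x : xf\neq x\}$; a \emph{signed orbital} is a pair $(A,f)$ with $A$ an orbital of $f$, and $f$ is called its \emph{signature}. Order signed orbitals by $(A,f)\le(B,g)$ iff $A\subsetneq B$, or $A=B$ and $f=g$. For $C\subseteq \mathrm{PLo}(I)$ let $\mathcal{SO}(C)$ be the set of signed orbitals with signature in $C$. A \emph{tower} in a set $P$ of signed orbitals is a chain contained in $P$, and a tower in a subgroup $G$ is a tower in $\mathcal{SO}(G)$. An \emph{$n$-tower} ($n\in\mathbb N$) is a tower for which the ordered set of right endpoints of its orbitals has order type $n$. A tower is \emph{pure} if each of its signatures has exactly one orbital. A pair $f,g$ is \emph{untwisted} if, whenever $A,C$ are orbitals of $f$ and $B,D$ are orbitals of $g$ such that $[f,g]$ moves some point of $A\cap B$ and some point of $C\cap D$, the following hold: $A\subsetneq B$ implies $C\subsetneq D$, $B\subsetneq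 A$ implies $D\subsetneq C$, and $A=B$ implies $C=D$. A tower is \emph{untwisted} if any two of its signatures form an untwisted pair. Let $\varphi:G\to H$ be a homomorphism between subgroups of $\mathrm{PLo}(I)$ and $T$ a tower in $G$. Write $\varphi(T)$ for the set of all signed orbitals of the elements $\varphi(g)$, where $g$ runs over the signatures of $T$. For a tower $S$ in $\varphi(T)$, the \emph{induced map} $\hat\varphi_{(T,S)}:T\to S\cup\{\emptyset\}$ sends $(B,g)$ to the (unique) element of $S$ with signature $\varphi(g)$ if there is one, and to $\emptyset$ otherwise. \textbf{Theorem.} Let $\varphi:G\to H$ be an injective homomorphism between solvable subgroups of $\mathrm{PLo}(I)$, and let $T$ be an $n$-tower in $G$ that is pure or, more generally, untwisted. Then: \begin{enumerate} \item there is an $n$-tower in $\varphi(T)$; \item for every tower $U$ in $\varphi(T)$, the induced map $\hat\varphi_{(T,U)}$ is non-decreasing on the elements that are not mapped to $\emptyset$; \item there is a tower $S$ in $\varphi(T)$ such that the induced map $\hat\varphi_{(T,S)}$ is an isomorphism of ordered sets from $T$ onto $S$. \end{enumerate} -/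

import Mathlib

/-- An order automorphism of `I = [0,1]` (that is, an orientation-preserving homeomorphism of `I`)
is piecewise linear with finitely many breakpoints: there is a finite set `B` such that `f` is
affine on every closed interval whose interior misses `B`. -/
def IsPiecewiseLinear (f : unitInterval ≃o unitInterval) : Prop :=
  ∃ B : Set unitInterval, B.Finite ∧
    ∀ a b : unitInterval, a < b → Disjoint (Set.Ioo a b) B →
      ∃ m c : ℝ, ∀ x ∈ Set.Icc a b, (f x : ℝ) = m * (x : ℝ) + c

theorem IsPiecewiseLinear.one : IsPiecewiseLinear 1 :=
  ⟨∅, Set.finite_empty, fun _ _ _ _ => ⟨1, 0, fun x _ => by simp⟩⟩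

theorem IsPiecewiseLinear.mul {f g : unitInterval ≃o unitInterval}
    (hf : IsPiecewiseLinear f) (hg : IsPiecewiseLinear g) : IsPiecewiseLinear (f * g) := by
  obtain ⟨B, hB, hfB⟩ := hf
  obtain ⟨C, hC, hgC⟩ := hg
  refine ⟨C ∪ g ⁻¹' B, hC.union (hB.preimage g.injective.injOn), fun a b hab hd => ?_⟩
  rw [Set.disjoint_union_right] at hd
  obtain ⟨m, c, hmc⟩ := hgC a b hab hd.1
  have hd2 : Disjoint (Set.Ioo (g a) (g b)) B := by
    rw [Set.disjoint_left]
    intro y hy hyB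
    have hy' : g.symm y ∈ Set.Ioo a b :=
      ⟨(OrderIso.lt_symm_apply g).2 hy.1, (OrderIso.symm_apply_lt g).2 hy.2⟩
    exact Set.disjoint_left.1 hd.2 hy' (by simpa using hyB)
  obtain ⟨m', c', hmc'⟩ := hfB (g a) (g b) (g.strictMono hab) hd2
  refine ⟨m' * m, m' * c + c', fun x hx => ?_⟩
  have h1 := hmc x hx
  have h2 := hmc' (g x) ⟨g.monotone hx.1, g.monotone hx.2⟩
  rw [RelIso.mul_apply, h2, h1]
  ring

theorem IsPiecewiseLinear.inv {f : unitInterval ≃o unitInterval}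
    (hf : IsPiecewiseLinear f) : IsPiecewiseLinear f⁻¹ := by
  obtain ⟨B, hB, hfB⟩ := hf
  refine ⟨f '' B, hB.image f, fun a b hab hd => ?_⟩
  have hd2 : Disjoint (Set.Ioo (f.symm a) (f.symm b)) B := by
    rw [Set.disjoint_left]
    intro y hy hyB
    have hy' : f y ∈ Set.Ioo a b :=
      ⟨(OrderIso.symm_apply_lt f).1 hy.1, (OrderIso.lt_symm_apply f).1 hy.2⟩
    exact Set.disjoint_left.1 hd hy' ⟨y, hyB, rfl⟩
  have hab' : f.symm a < f.symm b := f.symm.strictMono hab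
  obtain ⟨m, c, hmc⟩ := hfB _ _ hab' hd2
  have hm : m ≠ 0 := by
    rintro rfl
    have h1 := hmc _ (Set.left_mem_Icc.2 hab'.le)
    have h2 := hmc _ (Set.right_mem_Icc.2 hab'.le)
    rw [OrderIso.apply_symm_apply] at h1 h2
    exact hab.ne (Subtype.ext (by rw [h1, h2]; ring))
  refine ⟨m⁻¹, -(m⁻¹ * c), fun x hx => ?_⟩
  have h := hmc (f.symm x) ⟨f.symm.monotone hx.1, f.symm.monotone hx.2⟩
  rw [OrderIso.apply_symm_apply] at h
  change ((f.symm x : unitInterval) : ℝ) = _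
  rw [h]
  field_simp
  ring

/-- The group `PLo(I)` of orientation-preserving piecewise linear homeomorphisms of the unit
interval with finitely many breakpoints. -/
def PLoI : Subgroup (unitInterval ≃o unitInterval) where
  carrier := {f | IsPiecewiseLinear f}
  one_mem' := IsPiecewiseLinear.one
  mul_mem' := IsPiecewiseLinear.mul
  inv_mem' := IsPiecewiseLinear.inv

/-- The image of a point of `I` under an element of `PLo(I)`. -/
def PLoI.act (f : PLoI) (x : unitInterval) : unitInterval :=
  (f : unitInterval ≃o unitInterval) x

/-- The support of `f`: the points that `f` moves. -/
def PLoI.supp (f : PLoI) : Set unitInterval :=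
  {x | PLoI.act f x ≠ x}

/-- `A` is an orbital of `f`: a maximal (nonempty) interval contained in the support of `f`. -/
def IsOrbital (f : PLoI) (A : Set unitInterval) : Prop :=
  Maximal (fun J : Set unitInterval => J.Nonempty ∧ J.OrdConnected ∧ J ⊆ PLoI.supp f) A

/-- A signed orbital: a pair `(A, f)` where `f ∈ PLo(I)` and `A` is an orbital of `f`. -/
@[ext]
structure SignedOrbital where
  orbital : Set unitInterval
  signature : PLoI
  isOrbital : IsOrbital signature orbital

/-- Signed orbitals are ordered lexicographically: orbitals by inclusion, signatures trivially. So
`(A, f) ≤ (B, g)` iff `A` is properly contained in `B`, or `A = B` and `f = g`. -/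
instance SignedOrbital.instPartialOrder : PartialOrder SignedOrbital where
  le p q := p.orbital ⊂ q.orbital ∨ (p.orbital = q.orbital ∧ p.signature = q.signature)
  le_refl p := Or.inr ⟨rfl, rfl⟩
  le_trans p q r hpq hqr := by
    rcases hpq with h | ⟨h, h'⟩ <;> rcases hqr with k | ⟨k, k'⟩
    · exact Or.inl (h.trans k)
    · exact Or.inl (k ▸ h)
    · exact Or.inl (h ▸ k)
    · exact Or.inr ⟨h.trans k, h'.trans k'⟩
  le_antisymm p q hpq hqp := by
    rcases hpq with h | ⟨h, h'⟩
    · rcases hqp with k | ⟨k, _⟩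
      · exact absurd (h.trans k) (ssubset_irrefl _)
      · exact absurd (k ▸ h) (ssubset_irrefl _)
    · exact SignedOrbital.ext h h'

/-- `SO(C)`: the set of all signed orbitals of the elements of `C ⊆ PLo(I)`. -/
def signedOrbitals (C : Set PLoI) : Set SignedOrbital :=
  {p | p.signature ∈ C}

/-- `S(T)`: the set of all signatures of a set `T` of signed orbitals. -/
def signatures (T : Set SignedOrbital) : Set PLoI :=
  SignedOrbital.signature '' T

/-- `T` is a tower in the poset `P` of signed orbitals: `T` is a chain contained in `P`. A tower in
a group `G` is a tower in `SO(G)`. -/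
def IsTowerIn (P T : Set SignedOrbital) : Prop :=
  T ⊆ P ∧ IsChain (· ≤ ·) T

/-- The set of right endpoints of the orbitals of `T`. -/
def rightEndpoints (T : Set SignedOrbital) : Set unitInterval :=
  {r | ∃ p ∈ T, IsLUB p.orbital r}

/-- `T` is an `n`-tower in `P`: a tower of type `n`, where the type of a tower is the order type of
the set of right endpoints of its orbitals. -/
def IsNTowerIn (P : Set SignedOrbital) (n : ℕ) (T : Set SignedOrbital) : Prop :=
  IsTowerIn P T ∧ Nonempty (rightEndpoints T ≃o Fin n)

/-- `f` is a one-bump function: it has exactly one orbital. -/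
def IsOneBump (f : PLoI) : Prop :=
  ∃! A : Set unitInterval, IsOrbital f A

/-- A set of signed orbitals is pure if all its signatures are one-bump functions. -/
def IsPure (T : Set SignedOrbital) : Prop :=
  ∀ f ∈ signatures T, IsOneBump f

/-- `[f, g] ≠ 1` at some point of `D`. With points acted on from the right, `[f, g] = f⁻¹g⁻¹fg`
first applies `f⁻¹`, then `g⁻¹`, then `f`, then `g`. -/
def NoncommutingOn (f g : PLoI) (D : Set unitInterval) : Prop :=
  ∃ x ∈ D, PLoI.act g (PLoI.act f (PLoI.act g⁻¹ (PLoI.act f⁻¹ x))) ≠ x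

/-- The pair `f, g` is untwisted: if `A`, `B` are orbitals of `f`, `g` with `[f, g] ≠ 1` at some
point of `A ∩ B`, then all orbitals `C`, `D` of `f`, `g` with `[f, g] ≠ 1` at some point of `C ∩ D`
are in the same configuration as `A`, `B`. -/
def IsUntwistedPair (f g : PLoI) : Prop :=
  ∀ A B : Set unitInterval, IsOrbital f A → IsOrbital g B → NoncommutingOn f g (A ∩ B) →
    ∀ C D : Set unitInterval, IsOrbital f C → IsOrbital g D → NoncommutingOn f g (C ∩ D) →
      (A ⊂ B → C ⊂ D) ∧ (B ⊂ A → D ⊂ C) ∧ (A = B → C = D)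

/-- A set of signed orbitals is untwisted if any two of its signatures form an untwisted pair. -/
def IsUntwisted (T : Set SignedOrbital) : Prop :=
  ∀ p ∈ T, ∀ q ∈ T, IsUntwistedPair p.signature q.signature

/-- `φ(T) = SO(φ(S(T)))`: all signed orbitals of the images under `φ` of the signatures of `T`. -/
def imageSignedOrbitals {G H : Subgroup PLoI} (φ : G →* H) (T : Set SignedOrbital) :
    Set SignedOrbital :=
  signedOrbitals {h | ∃ g : G, (g : PLoI) ∈ signatures T ∧ ((φ g : H) : PLoI) = h}

open Classical in
/-- The map `T → S ∪ {∅}` induced by `φ` (with `none` for `∅`): `(B, g)` goes to the element of `S`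
with signature `φ(g)` if there is one, and to `∅` otherwise. If `S` is a tower, it has at most one
element with a given signature, since distinct orbitals of one function are disjoint. -/
noncomputable def inducedMap {G H : Subgroup PLoI} (φ : G →* H) {T : Set SignedOrbital}
    (hT : T ⊆ signedOrbitals (G : Set PLoI)) (S : Set SignedOrbital) (p : T) : Option S :=
  if h : ∃ s : S, (s : SignedOrbital).signature =
      ((φ ⟨(p : SignedOrbital).signature, hT p.2⟩ : H) : PLoI)
  then some h.choose
  else none

/-- `m : T → S ∪ {∅}` is non-decreasing on the elements not mapped to `∅`. -/
def IsNondecreasingOffEmpty {T S : Set SignedOrbital} (m : T → Option S) : Prop :=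
  ∀ p q : T, p ≤ q → ∀ s t : S, m p = some s → m q = some t → s ≤ t

/-- `m : T → S ∪ {∅}` is an isomorphism of ordered sets from `T` onto `S`. -/
def IsOrderIsomorphism {T S : Set SignedOrbital} (m : T → Option S) : Prop :=
  ∃ e : T ≃o S, ∀ p : T, m p = some (e p)

open Filter
open scoped commutatorElement

namespace PLoI

/-! ### The action and orbitals as open intervals -/

/-! Three facts carry the proof.

First, solvability makes the geometry rigid. Two orbitals of elements of a solvable group that meet
are equal, or one contains the closure of the other (`laminar_of_isSolvable`). This climbs the
derived series from the bottom, together with the fact that no orbital is mapped strictly inside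
itself (`NoContraction`).

Second, nesting can be seen algebraically. Call `f` subordinate to `g` if `f` commutes with its
conjugates by all large powers of `g`. Injective homomorphisms preserve and reflect this. In a
laminar group it says exactly that every orbital of `f` is fixed pointwise by `g`, is an orbital of
`g` on which the two commute, or lies strictly inside an orbital of `g` (`nestedIn_of_subordinate`,
`subordinate_of_nestedIn`). Untwistedness extends one strict nesting to this condition on all
orbitals, so the signatures of the tower are pairwise subordinate, and so are their images.

Third, pairwise nesting must become one chain of orbitals of the images (`exists_nestedOrbs_map`).
For the top signatures `f`, `g` and large `m`, the commutator of `f` and `g ^ m` agrees with `f` on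
its orbital in the tower. Replacing `f` and `g` by this commutator shortens the tower by one. In
`H`, `Laminar.eventually_commutator` shows that the top orbital of the shorter chain is an orbital
of the image of `f` strictly inside one of the image of `g`. This restores the lost level; the case
of just two signatures uses non-commutation instead. -/

theorem smul_lt_smul {f : PLoI} {x y : unitInterval} : f • x < f • y ↔ x < y :=
  (f : unitInterval ≃o unitInterval).lt_iff_lt

theorem smul_le_smul {f : PLoI} {x y : unitInterval} : f • x ≤ f • y ↔ x ≤ y :=
  (f : unitInterval ≃o unitInterval).le_iff_le

theorem lt_inv_smul {f : PLoI} {x y : unitInterval} : x < f⁻¹ • y ↔ f • x < y := by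
  rw [← smul_lt_smul (f := f), smul_inv_smul]

theorem inv_smul_lt {f : PLoI} {x y : unitInterval} : f⁻¹ • x < y ↔ x < f • y := by
  rw [← smul_lt_smul (f := f), smul_inv_smul]

theorem inv_smul_of_smul_eq {f : PLoI} {x : unitInterval} (h : f • x = x) : f⁻¹ • x = x :=
  inv_smul_eq_iff.2 h.symm

theorem pow_smul_of_smul_eq {f : PLoI} {x : unitInterval} (h : f • x = x) (n : ℕ) :
    f ^ n • x = x :=
  (MulAction.stabilizer PLoI x).pow_mem (x := f) h n

theorem pow_inv_smul_of_smul_eq {f : PLoI} {x : unitInterval} (h : f • x = x) (n : ℕ) :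
    (f ^ n)⁻¹ • x = x :=
  inv_smul_of_smul_eq (pow_smul_of_smul_eq h n)

theorem commutator_smul (f g : PLoI) (x : unitInterval) :
    ⁅f, g⁆ • x = f • g • f⁻¹ • g⁻¹ • x := by
  simp only [commutatorElement_def, mul_smul]

theorem ext_smul {f g : PLoI} (h : ∀ x : unitInterval, f • x = g • x) : f = g :=
  Subtype.ext (RelIso.ext h)

/-- `a` and `b` are the endpoints of an orbital of `f`. -/
structure IsOrb (f : PLoI) (a b : unitInterval) : Prop where
  lt : a < b
  left : f • a = a
  right : f • b = b
  ne : ∀ x, a < x → x < b → f • x ≠ x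

theorem smul_sSup_of_fixed {f : PLoI} {s : Set unitInterval} (h : ∀ y ∈ s, f • y = y) :
    f • sSup s = sSup s := by
  have h1 : f • sSup s = ⨆ a ∈ s, f • a := (f : unitInterval ≃o unitInterval).map_sSup s
  rw [h1, sSup_eq_iSup]
  exact iSup_congr fun a => iSup_congr (h a)

theorem smul_sInf_of_fixed {f : PLoI} {s : Set unitInterval} (h : ∀ y ∈ s, f • y = y) :
    f • sInf s = sInf s := by
  have h1 : f • sInf s = ⨅ a ∈ s, f • a := (f : unitInterval ≃o unitInterval).map_sInf s
  rw [h1, sInf_eq_iInf]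
  exact iInf_congr fun a => iInf_congr (h a)

theorem exists_isOrb {f : PLoI} {x : unitInterval} (hx : f • x ≠ x) :
    ∃ a b, a < x ∧ x < b ∧ IsOrb f a b := by
  let s : Set unitInterval := {y | y ≤ x ∧ f • y = y}
  let t : Set unitInterval := {y | x ≤ y ∧ f • y = y}
  have hs : f • sSup s = sSup s := smul_sSup_of_fixed fun y hy => hy.2
  have ht : f • sInf t = sInf t := smul_sInf_of_fixed fun y hy => hy.2
  have hsx : sSup s < x := lt_of_le_of_ne (sSup_le fun y hy => hy.1) fun h => hx (h ▸ hs)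
  have htx : x < sInf t := lt_of_le_of_ne (le_sInf fun y hy => hy.1) fun h => hx (h.symm ▸ ht)
  refine ⟨sSup s, sInf t, hsx, htx, hsx.trans htx, hs, ht, fun y hy1 hy2 hy => ?_⟩
  rcases le_total y x with h | h
  · exact hy1.not_ge (le_sSup ⟨h, hy⟩)
  · exact hy2.not_ge (sInf_le ⟨h, hy⟩)

namespace IsOrb

variable {f g : PLoI} {a b c d x y : unitInterval}

theorem fixed_le (h : IsOrb f a b) (hx : f • x = x) : x ≤ a ∨ b ≤ x := by
  by_contra! hc
  exact h.ne x hc.1 hc.2 hx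

theorem fixed_le_left (h : IsOrb f a b) (hx : f • x = x) (hxb : x < b) : x ≤ a :=
  (h.fixed_le hx).resolve_right hxb.not_ge

theorem right_le_fixed (h : IsOrb f a b) (hx : f • x = x) (hxb : a < x) : b ≤ x :=
  (h.fixed_le hx).resolve_left hxb.not_ge

theorem eq_of_mem (h : IsOrb f a b) (h' : IsOrb f c d) (h1 : a < x) (h2 : x < b) (h3 : c < x)
    (h4 : x < d) : a = c ∧ b = d :=
  ⟨le_antisymm (h'.fixed_le_left h.left (h1.trans h4)) (h.fixed_le_left h'.left (h3.trans h2)),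
    le_antisymm (h.right_le_fixed h'.right (h1.trans h4))
      (h'.right_le_fixed h.right (h3.trans h2))⟩

theorem conj (h : IsOrb f a b) (k : PLoI) : IsOrb (k * f * k⁻¹) (k • a) (k • b) where
  lt := smul_lt_smul.2 h.lt
  left := by simp [mul_smul, h.left]
  right := by simp [mul_smul, h.right]
  ne x h1 h2 h3 := by
    refine h.ne (k⁻¹ • x) (lt_inv_smul.2 h1) (inv_smul_lt.2 h2) ?_
    rw [mul_smul, mul_smul] at h3
    rw [eq_inv_smul_iff, h3]

theorem inv (h : IsOrb f a b) : IsOrb f⁻¹ a b where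
  lt := h.lt
  left := inv_smul_of_smul_eq h.left
  right := inv_smul_of_smul_eq h.right
  ne x h1 h2 h3 := h.ne x h1 h2 (inv_smul_eq_iff.1 h3).symm

end IsOrb

theorem lt_smul_of_fixed {f : PLoI} {a x : unitInterval} (h : f • a = a) (hx : a < x) :
    a < f • x := by
  rw [← h]; exact smul_lt_smul.2 hx

theorem smul_lt_of_fixed {f : PLoI} {a x : unitInterval} (h : f • a = a) (hx : x < a) :
    f • x < a := by
  rw [← h]; exact smul_lt_smul.2 hx

theorem IsOrb.congr {f g : PLoI} {a b : unitInterval} (h : IsOrb f a b)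
    (hfg : ∀ x, a ≤ x → x ≤ b → g • x = f • x) : IsOrb g a b where
  lt := h.lt
  left := (hfg a le_rfl h.lt.le).trans h.left
  right := (hfg b h.lt.le le_rfl).trans h.right
  ne x h1 h2 := by rw [hfg x h1.le h2.le]; exact h.ne x h1 h2

/-! ### Germs of piecewise linear maps -/

theorem exists_affine_right (f : PLoI) {c : unitInterval} (hc : c < ⊤) :
    ∃ c', c < c' ∧ ∃ m k : ℝ, ∀ x ∈ Set.Icc c c', ((f • x : unitInterval) : ℝ) = m * x + k := by
  obtain ⟨B, hB, hf⟩ := f.2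
  have hfin : {y ∈ B | c < y}.Finite := hB.subset fun y hy => hy.1
  by_cases hne : {y ∈ B | c < y}.Nonempty
  · obtain ⟨y, hy, hmin⟩ := Set.exists_min_image _ id hfin hne
    refine ⟨y, hy.2, hf c y hy.2 (Set.disjoint_left.2 fun z hz hzB => ?_)⟩
    exact hz.2.not_ge (hmin z ⟨hzB, hz.1⟩)
  · exact ⟨⊤, hc, hf c ⊤ hc (Set.disjoint_left.2 fun z hz hzB => hne ⟨z, hzB, hz.1⟩)⟩

theorem exists_affine_left (f : PLoI) {c : unitInterval} (hc : ⊥ < c) :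
    ∃ c', c' < c ∧ ∃ m k : ℝ, ∀ x ∈ Set.Icc c' c, ((f • x : unitInterval) : ℝ) = m * x + k := by
  obtain ⟨B, hB, hf⟩ := f.2
  have hfin : {y ∈ B | y < c}.Finite := hB.subset fun y hy => hy.1
  by_cases hne : {y ∈ B | y < c}.Nonempty
  · obtain ⟨y, hy, hmax⟩ := Set.exists_max_image _ id hfin hne
    refine ⟨y, hy.2, hf y c hy.2 (Set.disjoint_left.2 fun z hz hzB => ?_)⟩
    exact hz.1.not_ge (hmax z ⟨hzB, hz.2⟩)
  · exact ⟨⊥, hc, hf ⊥ c hc (Set.disjoint_left.2 fun z hz hzB => hne ⟨z, hzB, hz.2⟩)⟩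

theorem fixed_of_affine {f : PLoI} {s : Set unitInterval} {m k : ℝ}
    (h : ∀ x ∈ s, ((f • x : unitInterval) : ℝ) = m * x + k) {p q : unitInterval} (hp : p ∈ s)
    (hq : q ∈ s) (hpq : p < q) (hfp : f • p = p) (hfq : f • q = q) :
    ∀ x ∈ s, f • x = x := by
  have h1 := h p hp
  have h2 := h q hq
  rw [hfp] at h1
  rw [hfq] at h2
  have hpq' : (p : ℝ) < q := hpq
  have hm : m = 1 := by
    have : (m - 1) * ((q : ℝ) - p) = 0 := by linarith
    rcases mul_eq_zero.1 this with h | h <;> linarith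
  intro x hx
  have h3 := h x hx
  subst hm
  exact Subtype.ext (by linarith)

/-- An affine piece with two fixed points is the identity, so fixed points to the right of `c`
either fill a neighbourhood or stay away from `c`. The point `c` itself need not be fixed. -/
theorem germ_right (f : PLoI) {c : unitInterval} (hc : c < ⊤) :
    ∃ c', c < c' ∧ ((∀ x, c ≤ x → x ≤ c' → f • x = x) ∨ ∀ x, c < x → x ≤ c' → f • x ≠ x) := by
  obtain ⟨c', hc', m, k, h⟩ := exists_affine_right f hc
  by_cases h1 : ∃ p, c < p ∧ p ≤ c' ∧ f • p = p
  · obtain ⟨p, hcp, hpc, hfp⟩ := h1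
    by_cases h2 : ∃ q, c < q ∧ q < p ∧ f • q = q
    · obtain ⟨q, hcq, hqp, hfq⟩ := h2
      exact ⟨c', hc', Or.inl fun x hx hx' => fixed_of_affine h
        ⟨hcq.le, hqp.le.trans hpc⟩ ⟨hcp.le, hpc⟩ hqp hfq hfp x ⟨hx, hx'⟩⟩
    · obtain ⟨r, hr, hr'⟩ := exists_between hcp
      exact ⟨r, hr, Or.inr fun x hx hx' hfx => h2 ⟨x, hx, hx'.trans_lt hr', hfx⟩⟩
  · exact ⟨c', hc', Or.inr fun x hx hx' hfx => h1 ⟨x, hx, hx', hfx⟩⟩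

theorem germ_left (f : PLoI) {c : unitInterval} (hc : ⊥ < c) :
    ∃ c', c' < c ∧ ((∀ x, c' ≤ x → x ≤ c → f • x = x) ∨ ∀ x, c' ≤ x → x < c → f • x ≠ x) := by
  obtain ⟨c', hc', m, k, h⟩ := exists_affine_left f hc
  by_cases h1 : ∃ p, p < c ∧ c' ≤ p ∧ f • p = p
  · obtain ⟨p, hcp, hpc, hfp⟩ := h1
    by_cases h2 : ∃ q, q < c ∧ p < q ∧ f • q = q
    · obtain ⟨q, hcq, hqp, hfq⟩ := h2
      exact ⟨c', hc', Or.inl fun x hx hx' => fixed_of_affine h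
        ⟨hpc, hcp.le⟩ ⟨hpc.trans hqp.le, hcq.le⟩ hqp hfp hfq x ⟨hx, hx'⟩⟩
    · obtain ⟨r, hr, hr'⟩ := exists_between hcp
      exact ⟨r, hr', Or.inr fun x hx hx' hfx => h2 ⟨x, hx', hr.trans_le hx, hfx⟩⟩
  · exact ⟨c', hc', Or.inr fun x hx hx' hfx => h1 ⟨x, hx', hx, hfx⟩⟩

/-- Near a common fixed point both maps are homotheties centred there, and these commute. -/
theorem commutator_germ_right {f g : PLoI} {c : unitInterval} (hc : c < ⊤) (hf : f • c = c)
    (hg : g • c = c) : ∃ c', c < c' ∧ ∀ x, c ≤ x → x ≤ c' → ⁅f, g⁆ • x = x := by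
  obtain ⟨c₁, hc₁, m₁, k₁, h₁⟩ := exists_affine_right f hc
  obtain ⟨c₂, hc₂, m₂, k₂, h₂⟩ := exists_affine_right g hc
  -- Up to `e`, both `x` and its images `f • x`, `g • x` stay on the affine pieces where the
  -- formulas apply.
  let e := min (min c₁ c₂) (min (f⁻¹ • c₂) (g⁻¹ • c₁))
  have he : c < e := lt_min (lt_min hc₁ hc₂)
    (lt_min (lt_smul_of_fixed (inv_smul_of_smul_eq hf) hc₂)
      (lt_smul_of_fixed (inv_smul_of_smul_eq hg) hc₁))
  have hcomm : ∀ x, c ≤ x → x ≤ e → f • g • x = g • f • x := by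
    intro x hx hxe
    have e1 : x ≤ c₁ := hxe.trans ((min_le_left _ _).trans (min_le_left _ _))
    have e2 : x ≤ c₂ := hxe.trans ((min_le_left _ _).trans (min_le_right _ _))
    have e3 : f • x ≤ c₂ := by
      rw [← smul_inv_smul f c₂]
      exact smul_le_smul.2 (hxe.trans ((min_le_right _ _).trans (min_le_left _ _)))
    have e4 : g • x ≤ c₁ := by
      rw [← smul_inv_smul g c₁]
      exact smul_le_smul.2 (hxe.trans ((min_le_right _ _).trans (min_le_right _ _)))
    have e5 : c ≤ f • x := by rw [← hf]; exact smul_le_smul.2 hx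
    have e6 : c ≤ g • x := by rw [← hg]; exact smul_le_smul.2 hx
    have a1 := h₁ c ⟨le_rfl, hc₁.le⟩
    have a2 := h₂ c ⟨le_rfl, hc₂.le⟩
    rw [hf] at a1
    rw [hg] at a2
    refine Subtype.ext ?_
    rw [h₁ _ ⟨e6, e4⟩, h₂ _ ⟨e5, e3⟩, h₁ _ ⟨hx, e1⟩, h₂ _ ⟨hx, e2⟩]
    have b1 : k₁ = c - m₁ * c := by linarith
    have b2 : k₂ = c - m₂ * c := by linarith
    rw [b1, b2]
    ring
  refine ⟨g • f • e, lt_smul_of_fixed hg (lt_smul_of_fixed hf he), fun y hy hye => ?_⟩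
  obtain ⟨x, rfl⟩ : ∃ x, y = g • f • x := ⟨f⁻¹ • g⁻¹ • y, by simp⟩
  have hxe : x ≤ e := smul_le_smul.1 (smul_le_smul.1 hye)
  have hx : c ≤ x := by
    refine smul_le_smul (f := f).1 (smul_le_smul (f := g).1 ?_)
    rwa [hf, hg]
  rw [commutator_smul, inv_smul_smul, inv_smul_smul, hcomm x hx hxe]

/-! ### Dynamics on an orbital -/

/-- The supremum of the forward orbit of `x` is a fixed point beyond `c`, hence at least `d`. -/
theorem IsOrb.eventually_lt {g : PLoI} {c d x y : unitInterval} (h : IsOrb g c d) (hx : c < x)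
    (hgx : x < g • x) (hy : y < d) : ∀ᶠ m : ℕ in atTop, y < g ^ m • x := by
  have hmono : Monotone fun m : ℕ => g ^ m • x :=
    monotone_nat_of_le_succ fun m => by
      rw [pow_succ, mul_smul]
      exact smul_le_smul.2 hgx.le
  have hfix : g • (⨆ m : ℕ, g ^ m • x) = ⨆ m : ℕ, g ^ m • x := by
    have h1 : g • (⨆ m : ℕ, g ^ m • x) = ⨆ m : ℕ, g • g ^ m • x :=
      (g : unitInterval ≃o unitInterval).map_iSup _
    rw [h1, ← hmono.iSup_nat_add 1]
    exact iSup_congr fun m => by rw [pow_succ', mul_smul]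
  have hxL : x ≤ ⨆ m : ℕ, g ^ m • x := by
    simpa using le_iSup (fun m : ℕ => g ^ m • x) 0
  have hd := h.right_le_fixed hfix (hx.trans_le hxL)
  obtain ⟨m, hm⟩ := lt_iSup_iff.1 (hy.trans_le hd)
  exact eventually_atTop.2 ⟨m, fun n hn => hm.trans_le (hmono hn)⟩

theorem IsOrb.eventually_shift {g : PLoI} {c d x y : unitInterval} (h : IsOrb g c d) (hx : c < x)
    (hxd : x < d) (hyd : y < d) :
    ∀ᶠ m : ℕ in atTop, y < g ^ m • x ∨ g ^ m • y < x := by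
  rcases lt_or_gt_of_ne (h.ne x hx hxd) with hgx | hgx
  · have h1 : x < g⁻¹ • x := lt_inv_smul.2 hgx
    filter_upwards [h.inv.eventually_lt hx h1 hyd] with m hm
    right
    rwa [inv_pow, lt_inv_smul] at hm
  · filter_upwards [h.eventually_lt hx hgx hyd] with m hm
    exact Or.inl hm

/-- Every point of an orbital is moved arbitrarily close to its left end by `f` or `f⁻¹`. -/
theorem IsOrb.exists_pow_lt {f : PLoI} {a b x y : unitInterval} (h : IsOrb f a b)
    (hxb : x < b) (hy : a < y) : ∃ m : ℕ, f ^ m • x < y ∨ f⁻¹ ^ m • x < y := by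
  obtain ⟨z, hz, hz'⟩ := exists_between (lt_min hy h.lt)
  have hzy := hz'.trans_le (min_le_left _ _)
  have hzb := hz'.trans_le (min_le_right _ _)
  obtain ⟨m, hm⟩ := (h.eventually_shift hz hzb hxb).exists
  rcases hm with hm | hm
  · refine ⟨m, Or.inr ?_⟩
    rw [inv_pow]
    exact (inv_smul_lt.2 hm).trans hzy
  · exact ⟨m, Or.inl (hm.trans hzy)⟩

/-- An orbital is determined by its left end. Infinitely many left ends would accumulate at some
`z`, but on each side of `z` the germ is trivial or free of fixed points, and neither allows left
ends arbitrarily close to `z`. -/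
theorem finite_setOf_isOrb (g : PLoI) :
    {p : unitInterval × unitInterval | IsOrb g p.1 p.2}.Finite := by
  have hinj : Set.InjOn Prod.fst {p : unitInterval × unitInterval | IsOrb g p.1 p.2} := by
    rintro ⟨a, b⟩ h ⟨c, d⟩ h' (rfl : a = c)
    simp only [Set.mem_ofPred_eq] at h h'
    obtain ⟨x, hx, hx'⟩ := exists_between (lt_min h.lt h'.lt)
    rw [(h.eq_of_mem h' hx (hx'.trans_le (min_le_left _ _)) hx
      (hx'.trans_le (min_le_right _ _))).2]
  refine Set.Finite.of_finite_image ?_ hinj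
  by_contra hinf
  obtain ⟨z, -, hz⟩ := Set.Infinite.exists_accPt_of_subset_isCompact hinf isCompact_univ
    (Set.subset_univ _)
  have hR : ∀ᶠ x in nhdsWithin z (Set.Ioi z),
      x ∉ Prod.fst '' {p : unitInterval × unitInterval | IsOrb g p.1 p.2} := by
    rcases eq_or_ne z ⊤ with rfl | hzt
    · simp
    obtain ⟨c', hc', h⟩ := germ_right g hzt.lt_top
    filter_upwards [Ioo_mem_nhdsGT hc'] with x hx
    rintro ⟨⟨a, b⟩, hab, rfl⟩
    simp only [Set.mem_ofPred_eq] at hab hx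
    rcases h with h | h
    · obtain ⟨y, hy, hy'⟩ := exists_between (lt_min hab.lt hx.2)
      exact hab.ne y hy (hy'.trans_le (min_le_left _ _))
        (h y (hx.1.trans hy).le (hy'.trans_le (min_le_right _ _)).le)
    · exact h a hx.1 hx.2.le hab.left
  have hL : ∀ᶠ x in nhdsWithin z (Set.Iio z),
      x ∉ Prod.fst '' {p : unitInterval × unitInterval | IsOrb g p.1 p.2} := by
    rcases eq_or_ne z ⊥ with rfl | hzt
    · simp
    obtain ⟨c', hc', h⟩ := germ_left g hzt.bot_lt
    filter_upwards [Ioo_mem_nhdsLT hc'] with x hx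
    rintro ⟨⟨a, b⟩, hab, rfl⟩
    simp only [Set.mem_ofPred_eq] at hab hx
    rcases h with h | h
    · obtain ⟨y, hy, hy'⟩ := exists_between (lt_min hab.lt hx.2)
      exact hab.ne y hy (hy'.trans_le (min_le_left _ _))
        (h y (hx.1.trans hy).le (hy'.trans_le (min_le_right _ _)).le)
    · exact h a hx.1.le hx.2 hab.left
  rw [accPt_iff_frequently_nhdsNE] at hz
  apply hz
  rw [← Set.Iio_union_Ioi, nhdsWithin_union]
  exact eventually_sup.2 ⟨hL, hR⟩

end PLoI

namespace PLoI

/-! ### Maps that are trivial near the ends of an interval -/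

/-- On `[c, d]`, the map `f` is the identity outside `[c', d']`. -/
structure Hull (f : PLoI) (c d c' d' : unitInterval) : Prop where
  lt_left : c < c'
  left_lt : c' < d
  lt_right : c < d'
  right_lt : d' < d
  left : ∀ x, c ≤ x → x ≤ c' → f • x = x
  right : ∀ x, d' ≤ x → x ≤ d → f • x = x

namespace Hull

variable {f g : PLoI} {a b c d c' d' c₁ d₁ x : unitInterval}

theorem mono (h : Hull f c d c' d') (h1 : c < c₁) (h2 : c₁ ≤ c') (h3 : d' ≤ d₁) (h4 : d₁ < d) :
    Hull f c d c₁ d₁ where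
  lt_left := h1
  left_lt := h2.trans_lt h.left_lt
  lt_right := h.lt_right.trans_le h3
  right_lt := h4
  left x hx hx' := h.left x hx (hx'.trans h2)
  right x hx hx' := h.right x (h3.trans hx) hx'

theorem fix_left (h : Hull f c d c' d') : f • c = c := h.left c le_rfl h.lt_left.le

theorem fix_right (h : Hull f c d c' d') : f • d = d := h.right d h.right_lt.le le_rfl

theorem mem (h : Hull f c d c' d') (hc : c < x) (hd : x < d) (hx : f • x ≠ x) :
    c' < x ∧ x < d' := by
  constructor
  · by_contra! h1
    exact hx (h.left x hc.le h1)
  · by_contra! h1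
    exact hx (h.right x h1 hd.le)

theorem orb_mem (h : Hull f c d c' d') (ho : IsOrb f a b) (ha : a < x) (hb : x < b) (hc : c < x)
    (hd : x < d) : c' ≤ a ∧ b ≤ d' := by
  have h1 := h.mem hc hd (ho.ne x ha hb)
  exact ⟨ho.fixed_le_left (h.left c' h.lt_left.le le_rfl) (h1.1.trans hb),
    ho.right_le_fixed (h.right d' le_rfl h.right_lt.le) (ha.trans h1.2)⟩

theorem outside (h : Hull f c d c' d') (hc : c < x) (hd : x < d) (hx : x < c' ∨ d' < x) :
    f • x = x := by
  rcases hx with hx | hx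
  · exact h.left x hc.le hx.le
  · exact h.right x hx.le hd.le

end Hull

theorem IsOrb.eventually_outside {g : PLoI} {c d c' d' : unitInterval} (hg : IsOrb g c d)
    (h1 : c < c') (h2 : c' < d) (h4 : d' < d) :
    ∀ᶠ m : ℕ in atTop, ∀ x, c' ≤ x → x ≤ d' →
      c < (g ^ m)⁻¹ • x ∧ (g ^ m)⁻¹ • x < d ∧ ((g ^ m)⁻¹ • x < c' ∨ d' < (g ^ m)⁻¹ • x) := by
  filter_upwards [hg.eventually_shift h1 h2 h4] with m hm x hx hx'
  refine ⟨lt_smul_of_fixed (pow_inv_smul_of_smul_eq hg.left m) (h1.trans_le hx),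
    smul_lt_of_fixed (pow_inv_smul_of_smul_eq hg.right m) (hx'.trans_lt h4), ?_⟩
  rcases hm with hm | hm
  · exact Or.inl (inv_smul_lt.2 (hx'.trans_lt hm))
  · exact Or.inr (lt_inv_smul.2 (hm.trans_le hx))

/-- The commutator is `f` times the conjugate of `f⁻¹` by `g ^ m`, and a large power of `g` pushes
the support of that conjugate in `(c, d)` off the interval `[c', d']`. -/
theorem IsOrb.eventually_commutator {f g : PLoI} {c d c' d' : unitInterval} (hg : IsOrb g c d)
    (h : Hull f c d c' d') :
    ∀ᶠ m : ℕ in atTop, ∀ x, c' ≤ x → x ≤ d' → ⁅f, g ^ m⁆ • x = f • x := by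
  filter_upwards [hg.eventually_outside h.lt_left h.left_lt h.right_lt] with m hm x hx hx'
  obtain ⟨h1, h2, h3⟩ := hm x hx hx'
  rw [commutator_smul, inv_smul_of_smul_eq (h.outside h1 h2 h3), smul_inv_smul]

/-! ### Orbitals in solvable groups are disjoint, equal or strictly nested -/

/-- Orbitals of elements of `N` that meet are equal, or one contains the closure of the other. -/
def Laminar (N : Subgroup PLoI) : Prop :=
  ∀ f ∈ N, ∀ g ∈ N, ∀ a b c d x : unitInterval, IsOrb f a b → IsOrb g c d → a < x → x < b →
    c < x → x < d → (a = c ∧ b = d) ∨ (c < a ∧ b < d) ∨ (a < c ∧ d < b)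

/-- No orbital of an element of `N` is mapped strictly inside itself by a map normalizing `N`. -/
def NoContraction (N : Subgroup PLoI) : Prop :=
  ∀ k : PLoI, N.map (MulAut.conj k).toMonoidHom ≤ N → ∀ s ∈ N, ∀ u v : unitInterval,
    IsOrb s u v → u < k • u → k • v < v → False

/-- If the germ of `f` at `c` were nontrivial, the orbital of `f` next to `c` would lie strictly
inside `(c, d)`, since `f` fixes `p`; its left end would then be a fixed point arbitrarily close to
`c`. The same argument works at `d`. -/
theorem Laminar.exists_hull {N : Subgroup PLoI} (hN : Laminar N) {f g : PLoI} (hf : f ∈ N)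
    (hg : g ∈ N) {c d p : unitInterval} (ho : IsOrb g c d) (hc : c < p) (hd : p < d)
    (hp : f • p = p) : ∃ c' d', Hull f c d c' d' := by
  have key : ∀ z, c < z → z < d → f • z ≠ z →
      (z < p → ∃ y, c < y ∧ y < z ∧ f • y = y) ∧ (p < z → ∃ y, z < y ∧ y < d ∧ f • y = y) := by
    intro z hz hz' hfz
    obtain ⟨a, b, ha, hb, hab⟩ := exists_isOrb hfz
    rcases hN f hf g hg a b c d z hab ho ha hb hz hz' with ⟨rfl, rfl⟩ | h | h
    · exact absurd hp (hab.ne p hc hd)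
    · exact ⟨fun _ => ⟨a, h.1, ha, hab.left⟩, fun _ => ⟨b, hb, h.2, hab.right⟩⟩
    · exact absurd hp (hab.ne p (h.1.trans hc) (hd.trans h.2))
  have hL : ∃ c', c < c' ∧ c' < d ∧ ∀ x, c ≤ x → x ≤ c' → f • x = x := by
    obtain ⟨c₁, hc₁, h⟩ := germ_right f (ho.lt.trans_le le_top)
    refine ⟨min c₁ p, lt_min hc₁ hc, (min_le_right _ _).trans_lt hd, ?_⟩
    rcases h with h | h
    · exact fun x hx hx' => h x hx (hx'.trans (min_le_left _ _))
    · have hz : f • min c₁ p ≠ min c₁ p := h _ (lt_min hc₁ hc) (min_le_left _ _)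
      have hzp : min c₁ p < p := lt_of_le_of_ne (min_le_right _ _) fun he => hz (he.symm ▸ hp)
      obtain ⟨y, hy, hy', hfy⟩ := (key _ (lt_min hc₁ hc) (hzp.trans hd) hz).1 hzp
      exact absurd hfy (h y hy (hy'.le.trans (min_le_left _ _)))
  have hR : ∃ d', c < d' ∧ d' < d ∧ ∀ x, d' ≤ x → x ≤ d → f • x = x := by
    obtain ⟨d₁, hd₁, h⟩ := germ_left f (bot_le.trans_lt ho.lt)
    refine ⟨max d₁ p, hc.trans_le (le_max_right _ _), max_lt hd₁ hd, ?_⟩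
    rcases h with h | h
    · exact fun x hx hx' => h x ((le_max_left _ _).trans hx) hx'
    · have hz : f • max d₁ p ≠ max d₁ p := h _ (le_max_left _ _) (max_lt hd₁ hd)
      have hzp : p < max d₁ p := lt_of_le_of_ne (le_max_right _ _) fun he => hz (he ▸ hp)
      obtain ⟨y, hy, hy', hfy⟩ := (key _ (hc.trans hzp) (max_lt hd₁ hd) hz).2 hzp
      exact absurd hfy (h y ((le_max_left _ _).trans hy.le) hy')
  obtain ⟨c', h1, h2, h3⟩ := hL
  obtain ⟨d', h4, h5, h6⟩ := hR
  exact ⟨c', d', h1, h2, h4, h5, h3, h6⟩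

theorem map_conj_le {N : Subgroup PLoI} {k : PLoI} (hk : k ∈ N) :
    N.map (MulAut.conj k).toMonoidHom ≤ N := by
  rintro _ ⟨n, hn, rfl⟩
  exact N.mul_mem (N.mul_mem hk hn) (N.inv_mem hk)

theorem map_conj_commutator_le {N : Subgroup PLoI} {k : PLoI}
    (hk : N.map (MulAut.conj k).toMonoidHom ≤ N) :
    (⁅N, N⁆ : Subgroup PLoI).map (MulAut.conj k).toMonoidHom ≤ ⁅N, N⁆ := by
  rw [Subgroup.map_commutator]
  exact Subgroup.commutator_mono hk hk

theorem conj_mem_of_map_le {N : Subgroup PLoI} {k s : PLoI}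
    (hk : N.map (MulAut.conj k).toMonoidHom ≤ N) (hs : s ∈ N) : k * s * k⁻¹ ∈ N :=
  hk ⟨s, hs, rfl⟩

/-- If `k` contracts an orbital of `s`, then `k * s * k⁻¹` has an orbital strictly inside it, which
is also an orbital of a commutator with a power of `s`. Applying `k` again contracts that one, one
step further down the derived series. The element `k` is only required to normalize in one
direction, so it remains admissible for the smaller group. -/
theorem NoContraction.of_commutator {N : Subgroup PLoI} (hN : Laminar N)
    (h : NoContraction ⁅N, N⁆) : NoContraction N := by
  intro k hk s hs u v ho hu hv
  have hs' := conj_mem_of_map_le hk hs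
  have hok := ho.conj k
  obtain ⟨x, hx, hx'⟩ := exists_between hok.lt
  obtain ⟨c', d', hh⟩ := hN.exists_hull hs' hs ho hu (hok.lt.trans hv) hok.left
  obtain ⟨h1, h2⟩ := hh.orb_mem hok hx hx' (hu.trans hx) (hx'.trans hv)
  obtain ⟨m, hm⟩ := (ho.eventually_commutator hh).exists
  exact h k (map_conj_commutator_le hk) _
    (Subgroup.commutator_mem_commutator hs' (N.pow_mem hs m)) _ _
    (hok.congr fun y hy hy' => hm y (h1.trans hy) (hy'.trans h2))
    (smul_lt_smul.2 hu) (smul_lt_smul.2 hv)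

/-- Orbitals of elements of the commutator subgroup are blocks for the action of the group. -/
theorem block_of_commutator {N : Subgroup PLoI} (hL : Laminar ⁅N, N⁆)
    (hC : NoContraction ⁅N, N⁆) {k s : PLoI} (hk : k ∈ N) (hs : s ∈ (⁅N, N⁆ : Subgroup PLoI))
    {u v : unitInterval} (ho : IsOrb s u v) :
    (k • u = u ∧ k • v = v) ∨ k • v ≤ u ∨ v ≤ k • u := by
  by_cases h1 : k • v ≤ u
  · exact Or.inr (Or.inl h1)
  by_cases h2 : v ≤ k • u
  · exact Or.inr (Or.inr h2)
  rw [not_le] at h1 h2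
  have hok := ho.conj k
  obtain ⟨x, hx, hx'⟩ := exists_between (max_lt (lt_min ho.lt h1) (lt_min h2 hok.lt))
  have hn : ∀ {k}, k ∈ N → (⁅N, N⁆ : Subgroup PLoI).map (MulAut.conj k).toMonoidHom ≤ ⁅N, N⁆ :=
    fun hk => map_conj_commutator_le (map_conj_le hk)
  -- The translate of `(u, v)` is an orbital of a conjugate of `s`. Strict nesting either way is a
  -- contraction by `k` or by `k⁻¹`.
  rcases hL _ (conj_mem_of_map_le (hn hk) hs) s hs _ _ u v x hok ho
    ((le_max_right _ _).trans_lt hx) (hx'.trans_le (min_le_right _ _))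
    ((le_max_left _ _).trans_lt hx) (hx'.trans_le (min_le_left _ _)) with h | h | h
  · exact Or.inl h
  · exact (hC k (hn hk) s hs u v ho h.1 h.2).elim
  · exact (hC k⁻¹ (hn (N.inv_mem hk)) s hs u v ho (lt_inv_smul.2 h.1) (inv_smul_lt.2 h.2)).elim

/-- The commutator of `g⁻¹` and `f` moves `p`, so it has an orbital `(u, v)` around `p`. This is a
block for `f`, which fixes `p`; hence `f` fixes its ends and `(a, b)` lies inside it. If `g` fixed
the ends too, the commutator would be trivial near `u`. So `g` moves `(u, v)` off itself, which
keeps `[a, b]` inside `(c, d)`. -/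
theorem strictly_nested_of_endpoint {N : Subgroup PLoI} (hL : Laminar ⁅N, N⁆)
    (hC : NoContraction ⁅N, N⁆) {f g : PLoI} (hf : f ∈ N) (hg : g ∈ N) {a b c d p : unitInterval}
    (hab : IsOrb f a b) (hcd : IsOrb g c d) (hfp : f • p = p) (hap : a ≤ p) (hpb : p ≤ b)
    (hcp : c < p) (hpd : p < d) (hga : a < g • p) (hgb : g • p < b) : c < a ∧ b < d := by
  have hs : ⁅g⁻¹, f⁆ ∈ (⁅N, N⁆ : Subgroup PLoI) :=
    Subgroup.commutator_mem_commutator (N.inv_mem hg) hf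
  have hsp : ⁅g⁻¹, f⁆ • p ≠ p := by
    rw [commutator_smul, inv_smul_of_smul_eq hfp, inv_inv, Ne, inv_smul_eq_iff]
    exact hab.ne _ hga hgb
  obtain ⟨u, v, hu, hv, ho⟩ := exists_isOrb hsp
  have hfuv : f • u = u ∧ f • v = v := by
    rcases block_of_commutator hL hC hf hs ho with h | h | h
    · exact h
    · exact absurd (smul_lt_smul (f := f).2 hv) (by rw [hfp]; exact (h.trans hu.le).not_gt)
    · exact absurd (smul_lt_smul (f := f).2 hu) (by rw [hfp]; exact (hv.le.trans h).not_gt)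
  have hua : u ≤ a := hab.fixed_le_left hfuv.1 (hu.trans_le hpb)
  have hvb : b ≤ v := hab.right_le_fixed hfuv.2 (hap.trans_lt hv)
  rcases block_of_commutator hL hC hg hs ho with h | h | h
  · obtain ⟨w, hw, hfix⟩ := commutator_germ_right (ho.lt.trans_le le_top)
      (inv_smul_of_smul_eq h.1) hfuv.1
    obtain ⟨y, hy, hy'⟩ := exists_between (lt_min hw ho.lt)
    exact absurd (hfix y hy.le (hy'.trans_le (min_le_left _ _)).le)
      (ho.ne y hy (hy'.trans_le (min_le_right _ _)))
  · refine ⟨?_, ?_⟩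
    · exact ((lt_smul_of_fixed hcd.left (hcp.trans hv)).trans_le h).trans_le hua
    · by_contra! hd
      have h1 : d ≤ g • v := by
        rw [← hcd.right]
        exact smul_le_smul.2 (hd.trans hvb)
      exact (h1.trans h).not_gt (hu.trans hpd)
  · refine ⟨?_, ?_⟩
    · by_contra! hc
      have h1 : g • u ≤ c := by
        rw [← hcd.left]
        exact smul_le_smul.2 (hua.trans hc)
      exact (h.trans h1).not_gt (hcp.trans hv)
    · exact (hvb.trans h).trans_lt (smul_lt_of_fixed hcd.right (hu.trans hpd))

theorem Laminar.of_commutator {N : Subgroup PLoI} (hL : Laminar ⁅N, N⁆)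
    (hC : NoContraction ⁅N, N⁆) : Laminar N := by
  have key1 : ∀ f ∈ N, ∀ g ∈ N, ∀ a b c d : unitInterval, IsOrb f a b → IsOrb g c d → c < b →
      b < d → c < a := by
    intro f hf g hg a b c d hab hcd hcb hbd
    by_contra! hac
    -- Passing to the inverse if necessary, assume that the map moves `b` to the left; the image
    -- then lies in `(a, b)`.
    have main : ∀ k ∈ N, IsOrb k c d → k • b < b → False := by
      intro k hk hcd hkb
      have := lt_smul_of_fixed hcd.left hcb
      exact (strictly_nested_of_endpoint hL hC hf hk hab hcd hab.right hab.lt.le le_rfl hcb hbd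
        (hac.trans_lt this) hkb).1.not_ge hac
    rcases lt_or_gt_of_ne (hcd.ne b hcb hbd) with h | h
    · exact main g hg hcd h
    · exact main g⁻¹ (N.inv_mem hg) hcd.inv (inv_smul_lt.2 h)
  have key2 : ∀ f ∈ N, ∀ g ∈ N, ∀ a b c d : unitInterval, IsOrb f a b → IsOrb g c d → c < a →
      a < d → b < d := by
    intro f hf g hg a b c d hab hcd hca had
    by_contra! hdb
    have main : ∀ k ∈ N, IsOrb k c d → a < k • a → False := by
      intro k hk hcd hka
      have := smul_lt_of_fixed hcd.right had
      exact (strictly_nested_of_endpoint hL hC hf hk hab hcd hab.left le_rfl hab.lt.le hca had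
        hka (this.trans_le hdb)).2.not_ge hdb
    rcases lt_or_gt_of_ne (hcd.ne a hca had) with h | h
    · exact main g⁻¹ (N.inv_mem hg) hcd.inv (lt_inv_smul.2 h)
    · exact main g hg hcd h
  intro f hf g hg a b c d x hab hcd hax hxb hcx hxd
  rcases lt_trichotomy b d with h | rfl | h
  · exact Or.inr (Or.inl ⟨key1 f hf g hg a b c d hab hcd (hcx.trans hxb) h, h⟩)
  · rcases lt_trichotomy a c with h | h | h
    · exact absurd (key2 g hg f hf c b a b hcd hab h hcd.lt) (lt_irrefl _)
    · exact Or.inl ⟨h, rfl⟩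
    · exact absurd (key2 f hf g hg a b c b hab hcd h hab.lt) (lt_irrefl _)
  · exact Or.inr (Or.inr ⟨key1 g hg f hf c d a b hcd hab (hax.trans hxd) h, h⟩)

theorem laminar_of_isSolvable (G : Subgroup PLoI) (hG : Group.IsSolvable G) : Laminar G := by
  obtain ⟨n, hn⟩ := hG.solvable
  have hno : ∀ s ∈ (⊥ : Subgroup PLoI), ∀ u v : unitInterval, ¬ IsOrb s u v := by
    rintro s hs u v h
    obtain ⟨x, hx, hx'⟩ := exists_between h.lt
    exact h.ne x hx hx' (by rw [Subgroup.mem_bot.1 hs, one_smul])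
  -- Induction on `j` with `k = n - j`: it starts at the trivial term of the derived series and
  -- climbs to the whole group.
  have key : ∀ j k, j + k = n → Laminar ((derivedSeries G k).map G.subtype) ∧
      NoContraction ((derivedSeries G k).map G.subtype) := by
    intro j
    induction j with
    | zero =>
      rintro k hk
      obtain rfl : k = n := by omega
      rw [hn, Subgroup.map_bot]
      exact ⟨fun f hf _ _ a b _ _ _ h => absurd h (hno f hf a b),
        fun _ _ s hs u v h => absurd h (hno s hs u v)⟩
    | succ j ih =>
      intro k hk
      have h := ih (k + 1) (by omega)
      rw [derivedSeries_succ, Subgroup.map_commutator] at h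
      have hL := Laminar.of_commutator h.1 h.2
      exact ⟨hL, .of_commutator hL h.2⟩
  have h := (key n 0 (by omega)).1
  rwa [derivedSeries_zero, ← MonoidHom.range_eq_map, Subgroup.range_subtype] at h

end PLoI

namespace PLoI

/-! ### Subordination: an algebraic form of nesting -/

/-- `f` is subordinate to `g` if it commutes with its conjugates by all large powers of `g`. -/
def Subordinate {Γ : Type*} [Group Γ] (f g : Γ) : Prop :=
  ∀ᶠ m : ℕ in atTop, Commute (g ^ m * f * (g ^ m)⁻¹) f

theorem Subordinate.map {Γ Δ : Type*} [Group Γ] [Group Δ] (φ : Γ →* Δ) {f g : Γ}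
    (h : Subordinate f g) : Subordinate (φ f) (φ g) := by
  filter_upwards [h] with m hm
  simpa using Commute.map hm φ

theorem Subordinate.of_map {Γ Δ : Type*} [Group Γ] [Group Δ] {φ : Γ →* Δ}
    (hφ : Function.Injective φ) {f g : Γ} (h : Subordinate (φ f) (φ g)) : Subordinate f g := by
  filter_upwards [h] with m hm
  refine Commute.of_map hφ ?_
  simpa using hm

/-- `f` and `g` commute on the interval `(a, b)`. -/
def CommOn (f g : PLoI) (a b : unitInterval) : Prop :=
  ∀ x, a < x → x < b → f • g • x = g • f • x

section CommOn

variable {f g h : PLoI} {a b x : unitInterval}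

theorem CommOn.symm (H : CommOn f g a b) : CommOn g f a b :=
  fun x hx hx' => (H x hx hx').symm

theorem CommOn.inv_left (H : CommOn f g a b) (hfa : f • a = a) (hfb : f • b = b) :
    CommOn f⁻¹ g a b := by
  intro x hx hx'
  have := H (f⁻¹ • x) (lt_smul_of_fixed (inv_smul_of_smul_eq hfa) hx)
    (smul_lt_of_fixed (inv_smul_of_smul_eq hfb) hx')
  rw [smul_inv_smul] at this
  rw [inv_smul_eq_iff, this]

theorem CommOn.pow_right (H : CommOn f g a b) (hga : g • a = a) (hgb : g • b = b) (m : ℕ) :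
    CommOn f (g ^ m) a b := by
  induction m with
  | zero => intro x _ _; simp
  | succ m ih =>
    intro x hx hx'
    have h1 := lt_smul_of_fixed hga hx
    have h2 := smul_lt_of_fixed hgb hx'
    rw [pow_succ, mul_smul, mul_smul, ih _ h1 h2, H x hx hx']

theorem CommOn.fixed_pow_iff (H : CommOn f g a b) (hfa : f • a = a) (hfb : f • b = b) (hx : a < x)
    (hx' : x < b) (m : ℕ) : g • f ^ m • x = f ^ m • x ↔ g • x = x := by
  rw [H.symm.pow_right hfa hfb m x hx hx', smul_left_cancel_iff]

/-- A power of `f` or `f⁻¹` carries `x` below `w`, and commutation carries fixedness back. -/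
theorem IsOrb.forall_fixed_of_commOn (ho : IsOrb f a b) (H : CommOn f g a b) {w : unitInterval}
    (hw : a < w) (hfix : ∀ x, a < x → x < w → g • x = x) (hx : a < x) (hx' : x < b) :
    g • x = x := by
  obtain ⟨m, hm | hm⟩ := ho.exists_pow_lt hx' hw
  · exact (H.fixed_pow_iff ho.left ho.right hx hx' m).1
      (hfix _ (lt_smul_of_fixed (pow_smul_of_smul_eq ho.left m) hx) hm)
  · exact ((H.inv_left ho.left ho.right).fixed_pow_iff ho.inv.left ho.inv.right hx hx' m).1
      (hfix _ (lt_smul_of_fixed (pow_smul_of_smul_eq ho.inv.left m) hx) hm)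

/-- The images of `p` under powers of `f` or `f⁻¹` are fixed points of `g` arbitrarily close to `a`,
so the germ of `g` at `a` is trivial. -/
theorem IsOrb.forall_fixed_of_exists_fixed (ho : IsOrb f a b) (H : CommOn f g a b)
    {p : unitInterval} (hp : a < p) (hp' : p < b) (hgp : g • p = p) (hx : a < x) (hx' : x < b) :
    g • x = x := by
  obtain ⟨w, hw, hg | hg⟩ := germ_right g (ho.lt.trans_le le_top)
  · exact ho.forall_fixed_of_commOn H hw (fun y hy hy' => hg y hy.le hy'.le) hx hx'
  · obtain ⟨m, hm | hm⟩ := ho.exists_pow_lt hp' hw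
    · exact absurd ((H.fixed_pow_iff ho.left ho.right hp hp' m).2 hgp)
        (hg _ (lt_smul_of_fixed (pow_smul_of_smul_eq ho.left m) hp) hm.le)
    · exact absurd (((H.inv_left ho.left ho.right).fixed_pow_iff ho.inv.left ho.inv.right hp hp'
        m).2 hgp) (hg _ (lt_smul_of_fixed (pow_smul_of_smul_eq ho.inv.left m) hp) hm.le)

theorem Subordinate.commOn (hfg : Subordinate f g) (ho : IsOrb f a b) (hga : g • a = a)
    (hgb : g • b = b) : CommOn f g a b := by
  have key : ∀ m : ℕ, Commute (g ^ m * f * (g ^ m)⁻¹) f → CommOn f (g ^ m) a b := by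
    intro m hm
    have hgm := pow_smul_of_smul_eq hga m
    have hgm' := pow_smul_of_smul_eq hgb m
    -- `f` commutes with its conjugate, hence with that conjugate times `f⁻¹`. This commutator is
    -- trivial near `a`, so it is trivial on the whole orbital.
    have hc : Commute f ⁅g ^ m, f⁆ := hm.symm.mul_right (Commute.refl f).inv_right
    obtain ⟨w, hw, hfix⟩ := commutator_germ_right (ho.lt.trans_le le_top) hgm ho.left
    have hC : CommOn f ⁅g ^ m, f⁆ a b := fun x _ _ => by
      rw [← mul_smul, ← mul_smul, hc.eq]
    intro x hx hx'
    have h1 := ho.forall_fixed_of_commOn hC hw (fun y hy hy' => hfix y hy.le hy'.le)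
      (lt_smul_of_fixed ho.left (lt_smul_of_fixed hgm hx))
      (smul_lt_of_fixed ho.right (smul_lt_of_fixed hgm' hx'))
    rw [commutator_smul, inv_smul_smul, inv_smul_smul] at h1
    exact h1.symm
  -- Commutation with two consecutive powers of `g` gives commutation with `g`.
  obtain ⟨m, hm, hm'⟩ := (hfg.and ((tendsto_add_atTop_nat 1).eventually hfg)).exists
  intro x hx hx'
  have h1 := lt_smul_of_fixed (pow_inv_smul_of_smul_eq hga m) hx
  have h2 := smul_lt_of_fixed (pow_inv_smul_of_smul_eq hgb m) hx'
  have h3 := key m hm _ h1 h2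
  have h4 := key _ hm' _ h1 h2
  rw [pow_succ', mul_smul, mul_smul, ← h3, smul_inv_smul] at h4
  exact h4

end CommOn

/-! ### Geometric nesting and its equivalence with subordination -/

/-- Each orbital of `f` is fixed pointwise by `g`, or is an orbital of `g` on which `f` and `g`
commute, or lies strictly inside an orbital of `g`. -/
def NestedIn (f g : PLoI) : Prop :=
  ∀ a b : unitInterval, IsOrb f a b → (∀ x, a < x → x < b → g • x = x) ∨
    (IsOrb g a b ∧ CommOn f g a b) ∨ ∃ c d, IsOrb g c d ∧ c < a ∧ b < d

theorem NestedIn.of_mem {f g : PLoI} (H : NestedIn f g) {a b c d x : unitInterval}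
    (hab : IsOrb f a b) (hcd : IsOrb g c d) (hax : a < x) (hxb : x < b) (hcx : c < x)
    (hxd : x < d) : (a = c ∧ b = d ∧ CommOn f g a b) ∨ (c < a ∧ b < d) := by
  rcases H a b hab with h | ⟨h, hc⟩ | ⟨c', d', h, h1, h2⟩
  · exact absurd (h x hax hxb) (hcd.ne x hcx hxd)
  · obtain ⟨h1, h2⟩ := h.eq_of_mem hcd hax hxb hcx hxd
    exact Or.inl ⟨h1, h2, hc⟩
  · obtain ⟨rfl, rfl⟩ := h.eq_of_mem hcd (h1.trans hax) (hxb.trans h2) hcx hxd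
    exact Or.inr ⟨h1, h2⟩

theorem NestedIn.not_inside {f g : PLoI} (H : NestedIn f g) {a b c d : unitInterval}
    (hab : IsOrb f a b) (hcd : IsOrb g c d) (hac : a < c) (hdb : d < b) : False := by
  obtain ⟨x, hx, hx'⟩ := exists_between hcd.lt
  rcases H.of_mem hab hcd (hac.trans hx) (hx'.trans hdb) hx hx' with h | h
  · exact hac.ne h.1
  · exact hac.not_gt h.1

theorem Laminar.trichotomy {N : Subgroup PLoI} (hN : Laminar N) {f g : PLoI} (hf : f ∈ N)
    (hg : g ∈ N) {a b : unitInterval} (ho : IsOrb f a b) :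
    (∃ a' b', Hull g a b a' b') ∨ IsOrb g a b ∨ ∃ c d, IsOrb g c d ∧ c < a ∧ b < d := by
  obtain ⟨x, hx, hx'⟩ := exists_between ho.lt
  by_cases hgx : g • x = x
  · exact Or.inl (hN.exists_hull hg hf ho hx hx' hgx)
  obtain ⟨c, d, hc, hd, hcd⟩ := exists_isOrb hgx
  rcases hN f hf g hg a b c d x ho hcd hx hx' hc hd with ⟨rfl, rfl⟩ | h | h
  · exact Or.inr (Or.inl hcd)
  · exact Or.inr (Or.inr ⟨c, d, hcd, h⟩)
  · exact Or.inl (hN.exists_hull hg hf ho h.1 (hc.trans hx') hcd.left)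

theorem Laminar.nestedIn_of_subordinate {N : Subgroup PLoI} (hN : Laminar N) {f g : PLoI}
    (hf : f ∈ N) (hg : g ∈ N) (h : Subordinate f g) : NestedIn f g := by
  intro a b ho
  rcases hN.trichotomy hf hg ho with ⟨a', b', hh⟩ | h1 | h1
  · exact Or.inl fun x hx hx' => ho.forall_fixed_of_exists_fixed
      (h.commOn ho hh.fix_left hh.fix_right) hh.lt_left hh.left_lt
      (hh.left a' hh.lt_left.le le_rfl) hx hx'
  · exact Or.inr (Or.inl ⟨h1, h.commOn ho h1.left h1.right⟩)
  · exact Or.inr (Or.inr h1)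

theorem commute_of_moved {f g : PLoI}
    (h : ∀ x : unitInterval, f • x ≠ x → f • g • x = g • f • x ∧ f • g⁻¹ • x ≠ g⁻¹ • x) :
    Commute g f := by
  refine ext_smul fun x => ?_
  rw [mul_smul g f, mul_smul f g]
  by_cases hx : f • x = x
  · rw [hx]
    by_contra hne
    have := (h (g • x) (Ne.symm hne)).2
    rw [inv_smul_smul] at this
    exact this hx
  · exact (h x hx).1.symm

/-- On each orbital of `f`, the conjugate by a large power of `g` either agrees with `f` or is the
identity, so it commutes with `f`. -/
theorem Laminar.subordinate_of_nestedIn {N : Subgroup PLoI} (hN : Laminar N) {f g : PLoI}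
    (hf : f ∈ N) (hg : g ∈ N) (h : NestedIn f g) : Subordinate f g := by
  -- One bound on `m` serves all orbitals because `g` has only finitely many.
  have hev : ∀ᶠ m : ℕ in atTop, ∀ p ∈ {p : unitInterval × unitInterval | IsOrb g p.1 p.2},
      ∀ c' d', Hull f p.1 p.2 c' d' → ∀ x, p.1 < x → x < p.2 → f • x ≠ x →
        f • (g ^ m)⁻¹ • x = (g ^ m)⁻¹ • x := by
    rw [eventually_all_finite (finite_setOf_isOrb g)]
    rintro ⟨c, d⟩ (ho : IsOrb g c d)
    by_cases hex : ∃ c' d', Hull f c d c' d'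
    · obtain ⟨c', d', hh⟩ := hex
      filter_upwards [ho.eventually_outside hh.lt_left hh.left_lt hh.right_lt] with m hm
        _ _ _ x hx hx' hfx
      obtain ⟨h1, h2⟩ := hh.mem hx hx' hfx
      obtain ⟨h3, h4, h5⟩ := hm x h1.le h2.le
      exact hh.outside h3 h4 h5
    · exact Eventually.of_forall fun m c' d' hh => absurd ⟨c', d', hh⟩ hex
  filter_upwards [hev] with m hm
  set F := g ^ m * f * (g ^ m)⁻¹ with hF
  have hFs : ∀ x : unitInterval, F • x = g ^ m • f • (g ^ m)⁻¹ • x := fun x => by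
    simp only [hF, mul_smul]
  have key : ∀ a b, IsOrb f a b →
      (∀ x, a < x → x < b → F • x = f • x) ∨ (∀ x, a < x → x < b → F • x = x) := by
    intro a b ho
    rcases h a b ho with h1 | ⟨h1, h2⟩ | ⟨c, d, h1, h2, h3⟩
    · refine Or.inl fun x hx hx' => ?_
      rw [hFs, pow_inv_smul_of_smul_eq (h1 x hx hx'), pow_smul_of_smul_eq
        (h1 _ (lt_smul_of_fixed ho.left hx) (smul_lt_of_fixed ho.right hx'))]
    · refine Or.inl fun x hx hx' => ?_
      rw [hFs, ← h2.pow_right h1.left h1.right m _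
        (lt_smul_of_fixed (pow_inv_smul_of_smul_eq h1.left m) hx)
        (smul_lt_of_fixed (pow_inv_smul_of_smul_eq h1.right m) hx'), smul_inv_smul]
    · refine Or.inr fun x hx hx' => ?_
      obtain ⟨c', d', hh⟩ := hN.exists_hull hf hg h1 h2 (ho.lt.trans h3) ho.left
      rw [hFs, hm (c, d) h1 c' d' hh x (h2.trans hx) (hx'.trans h3) (ho.ne x hx hx'),
        smul_inv_smul]
  refine commute_of_moved fun x hx => ?_
  obtain ⟨a, b, ha, hb, ho⟩ := exists_isOrb hx
  have ha' := lt_smul_of_fixed ho.left ha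
  have hb' := smul_lt_of_fixed ho.right hb
  rcases key a b ho with h1 | h1
  · refine ⟨by rw [h1 _ ha hb, h1 _ ha' hb'], fun he => hx ?_⟩
    have e : F⁻¹ • x = f⁻¹ • x := by
      rw [inv_smul_eq_iff, h1 _ (lt_smul_of_fixed ho.inv.left ha)
        (smul_lt_of_fixed ho.inv.right hb), smul_inv_smul]
    rw [e, smul_inv_smul] at he
    exact (inv_smul_eq_iff.1 he.symm).symm
  · refine ⟨by rw [h1 _ ha hb, h1 _ ha' hb'], ?_⟩
    rwa [inv_smul_eq_iff.2 (h1 x ha hb).symm]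

/-! ### Untwisted pairs -/

/-- Otherwise `g⁻¹` would preserve the set of points of `(c, d)` moved by `f`, whereas its powers
eventually push `y` out of the hull of `f`. -/
theorem IsOrb.exists_noncommuting {f g : PLoI} {c d c' d' y : unitInterval} (ho : IsOrb g c d)
    (hh : Hull f c d c' d') (hy : c < y) (hy' : y < d) (hfy : f • y ≠ y) :
    ∃ z, c < z ∧ z < d ∧ f • z ≠ z ∧ ⁅g, f⁆ • z ≠ z := by
  by_contra! hcon
  have step : ∀ m : ℕ, f • (g ^ m)⁻¹ • y ≠ (g ^ m)⁻¹ • y := by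
    intro m
    induction m with
    | zero => simpa using hfy
    | succ m ih =>
      have h1 := lt_smul_of_fixed (pow_inv_smul_of_smul_eq ho.left m) hy
      have h2 := smul_lt_of_fixed (pow_inv_smul_of_smul_eq ho.right m) hy'
      have h3 := hcon _ h1 h2 ih
      intro h4
      rw [pow_succ, mul_inv_rev, mul_smul] at h4
      rw [commutator_smul, ← eq_inv_smul_iff, ← eq_inv_smul_iff, ← inv_smul_of_smul_eq h4] at h3
      generalize (g ^ m)⁻¹ • y = z at *
      rw [inv_smul_of_smul_eq h4, inv_smul_of_smul_eq h4] at h3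
      have h5 := inv_smul_eq_iff.1 (smul_left_cancel _ h3)
      exact ih h5.symm
  obtain ⟨h1, h2⟩ := hh.mem hy hy' hfy
  obtain ⟨m, hm⟩ := (ho.eventually_outside hh.lt_left hh.left_lt hh.right_lt).exists
  obtain ⟨h3, h4, h5⟩ := hm y h1.le h2.le
  exact step m (hh.outside h3 h4 h5)

theorem isOrbital_Ioo {f : PLoI} {a b : unitInterval} (h : IsOrb f a b) :
    IsOrbital f (Set.Ioo a b) := by
  refine ⟨⟨Set.nonempty_Ioo.2 h.lt, Set.ordConnected_Ioo, fun x hx => h.ne x hx.1 hx.2⟩, ?_⟩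
  rintro J ⟨-, hJ, hJf⟩ hle y hy
  obtain ⟨x, hx⟩ := Set.nonempty_Ioo.2 h.lt
  constructor
  · by_contra! hc
    exact hJf (hJ.out hy (hle hx) ⟨hc, hx.1.le⟩) h.left
  · by_contra! hc
    exact hJf (hJ.out (hle hx) hy ⟨hx.2.le, hc⟩) h.right

theorem exists_eq_Ioo {f : PLoI} {A : Set unitInterval} (h : IsOrbital f A) :
    ∃ a b, IsOrb f a b ∧ A = Set.Ioo a b := by
  obtain ⟨⟨⟨x, hx⟩, hA, hAf⟩, hmax⟩ := h
  obtain ⟨a, b, ha, hb, ho⟩ := exists_isOrb (hAf hx)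
  refine ⟨a, b, ho, ?_⟩
  have hsub : A ⊆ Set.Ioo a b := by
    intro y hy
    constructor
    · by_contra! hc
      exact hAf (hA.out hy hx ⟨hc, ha.le⟩) ho.left
    · by_contra! hc
      exact hAf (hA.out hx hy ⟨hb.le, hc⟩) ho.right
  exact hsub.antisymm (hmax (isOrbital_Ioo ho).1 hsub)

theorem noncommutingOn_iff {f g : PLoI} {D : Set unitInterval} :
    NoncommutingOn f g D ↔ ∃ x ∈ D, ⁅g, f⁆ • x ≠ x := by
  simp only [commutator_smul]
  rfl

/-- The strict nesting yields a point that the commutator moves, and untwistedness then forces every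
pair of orbitals meeting at such a point to be nested the same way. Any other behaviour on an
orbital of `f` would produce a pair in the wrong configuration. -/
theorem Laminar.nestedIn_of_isUntwistedPair {N : Subgroup PLoI} (hN : Laminar N) {f g : PLoI}
    (hf : f ∈ N) (hg : g ∈ N) (hu : IsUntwistedPair f g) {a b c d : unitInterval}
    (hab : IsOrb f a b) (hcd : IsOrb g c d) (hca : c < a) (hbd : b < d) : NestedIn f g := by
  obtain ⟨c', d', hh⟩ := hN.exists_hull hf hg hcd hca (hab.lt.trans hbd) hab.left
  obtain ⟨y, hy, hy'⟩ := exists_between hab.lt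
  -- The point `z` may lie in an orbital of `f` other than `(a, b)`; that orbital is still strictly
  -- inside `(c, d)`.
  obtain ⟨z, hz, hz', hfz, hzc⟩ := hcd.exists_noncommuting hh (hca.trans hy) (hy'.trans hbd)
    (hab.ne y hy hy')
  obtain ⟨a₀, b₀, ha₀, hb₀, hab₀⟩ := exists_isOrb hfz
  obtain ⟨h1, h2⟩ := hh.orb_mem hab₀ ha₀ hb₀ hz hz'
  have hss : Set.Ioo a₀ b₀ ⊂ Set.Ioo c d := by
    refine ⟨Set.Ioo_subset_Ioo (hh.lt_left.le.trans h1) (h2.trans hh.right_lt.le), fun h => ?_⟩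
    exact lt_irrefl a₀ (h ⟨hh.lt_left.trans_le h1, hab₀.lt.trans_le (h2.trans hh.right_lt.le)⟩).1
  have key : ∀ p q r s x, IsOrb f p q → IsOrb g r s → p < x → x < q → r < x → x < s →
      ⁅g, f⁆ • x ≠ x → Set.Ioo p q ⊂ Set.Ioo r s := fun p q r s x hpq hrs h1 h2 h3 h4 h5 =>
    (hu _ _ (isOrbital_Ioo hab₀) (isOrbital_Ioo hcd) (noncommutingOn_iff.2
      ⟨z, ⟨⟨ha₀, hb₀⟩, hz, hz'⟩, hzc⟩) _ _ (isOrbital_Ioo hpq) (isOrbital_Ioo hrs)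
      (noncommutingOn_iff.2 ⟨x, ⟨⟨h1, h2⟩, h3, h4⟩, h5⟩)).1 hss
  intro p q ho
  rcases hN.trichotomy hf hg ho with ⟨p', q', hh'⟩ | h | h
  · refine Or.inl fun x hx hx' => ?_
    by_contra hgx
    obtain ⟨w, hw, hw', hgw, hc⟩ := ho.exists_noncommuting hh' hx hx' hgx
    obtain ⟨r, s, hr, hs, hrs⟩ := exists_isOrb hgw
    obtain ⟨h3, h4⟩ := hh'.orb_mem hrs hr hs hw hw'
    have hc' : ⁅g, f⁆ • w ≠ w := by
      rw [← commutatorElement_inv]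
      exact fun h => hc (inv_smul_eq_iff.1 h).symm
    have h5 := (key p q r s w ho hrs hw hw' hr hs hc').1
      (⟨hh'.lt_left.trans_le h3, hrs.lt.trans_le (h4.trans hh'.right_lt.le)⟩ : r ∈ Set.Ioo p q)
    exact lt_irrefl r h5.1
  · refine Or.inr (Or.inl ⟨h, fun x hx hx' => ?_⟩)
    have h1 := lt_smul_of_fixed ho.left (lt_smul_of_fixed h.left hx)
    have h2 := smul_lt_of_fixed ho.right (smul_lt_of_fixed h.right hx')
    by_contra hne
    refine ssubset_irrefl _ (key p q p q _ ho h h1 h2 h1 h2 fun he => hne ?_)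
    rw [commutator_smul, inv_smul_smul, inv_smul_smul] at he
    exact he.symm
  · exact Or.inr (Or.inr h)

end PLoI

namespace PLoI

/-! ### Commutators inside a tower -/

section Commutator

variable {f g h : PLoI} {a b x : unitInterval}

theorem commutator_smul_eq_of_fixed_left (hx : f • x = x) (hx' : f • g⁻¹ • x = g⁻¹ • x) :
    ⁅f, g⁆ • x = x := by
  rw [commutator_smul, inv_smul_of_smul_eq hx', smul_inv_smul, hx]

theorem commutator_smul_eq_of_fixed_right (hx : g • x = x) (hx' : g • f⁻¹ • x = f⁻¹ • x) :
    ⁅f, g⁆ • x = x := by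
  rw [commutator_smul, inv_smul_of_smul_eq hx, hx', smul_inv_smul]

theorem CommOn.commutator_smul_eq (H : CommOn f g a b) (hf : IsOrb f a b) (hg : IsOrb g a b)
    (m : ℕ) (hx : a < x) (hx' : x < b) : ⁅f, g ^ m⁆ • x = x := by
  have h1 := lt_smul_of_fixed hf.inv.left
    (lt_smul_of_fixed (pow_inv_smul_of_smul_eq hg.left m) hx)
  have h2 := smul_lt_of_fixed hf.inv.right
    (smul_lt_of_fixed (pow_inv_smul_of_smul_eq hg.right m) hx')
  rw [commutator_smul, H.pow_right hg.left hg.right m _ h1 h2, smul_inv_smul, smul_inv_smul]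

end Commutator

/-- The commutator acts like `f` deep inside the orbitals of `g` and, around orbitals of `h`, is
trivial otherwise. In `G` this keeps `h` subordinate to the commutator; in `H` the last alternative
recovers orbitals of both `f` and `g` from one of the commutator. -/
theorem Laminar.eventually_commutator {N : Subgroup PLoI} (hN : Laminar N) {f g h : PLoI}
    (hf : f ∈ N) (hg : g ∈ N) (hh : h ∈ N) (hhf : NestedIn h f) (hhg : NestedIn h g)
    (hfg : NestedIn f g) : ∀ᶠ m : ℕ in atTop, ∀ a b, IsOrb h a b →
      (∀ x, a < x → x < b → ⁅f, g ^ m⁆ • x = x) ∨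
      (IsOrb ⁅f, g ^ m⁆ a b ∧ CommOn h ⁅f, g ^ m⁆ a b) ∨
      ∃ p q c d, IsOrb f p q ∧ IsOrb ⁅f, g ^ m⁆ p q ∧ IsOrb g c d ∧ p < a ∧ b < q ∧ c < p ∧
        q < d := by
  have hev : ∀ᶠ m : ℕ in atTop, ∀ p ∈ {p : unitInterval × unitInterval | IsOrb g p.1 p.2},
      (∃ c' d', Hull f p.1 p.2 c' d') → (∃ c' d', Hull h p.1 p.2 c' d') →
        ∃ c' d', Hull f p.1 p.2 c' d' ∧ Hull h p.1 p.2 c' d' ∧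
          ∀ x, c' ≤ x → x ≤ d' → ⁅f, g ^ m⁆ • x = f • x := by
    rw [eventually_all_finite (finite_setOf_isOrb g)]
    rintro ⟨c, d⟩ (ho : IsOrb g c d)
    by_cases hex : (∃ c' d', Hull f c d c' d') ∧ ∃ c' d', Hull h c d c' d'
    · obtain ⟨⟨c₁, d₁, h₁⟩, c₂, d₂, h₂⟩ := hex
      -- A common hull for `f` and `h`, so that the commutator agrees with `f` on every orbital of
      -- either map inside `(c, d)`.
      have hc : c < min c₁ c₂ := lt_min h₁.lt_left h₂.lt_left
      have hd : max d₁ d₂ < d := max_lt h₁.right_lt h₂.right_lt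
      have hf' := h₁.mono hc (min_le_left _ _) (le_max_left _ _) hd
      have hh' := h₂.mono hc (min_le_right _ _) (le_max_right _ _) hd
      filter_upwards [ho.eventually_commutator hf'] with m hm _ _
      exact ⟨_, _, hf', hh', hm⟩
    · exact Eventually.of_forall fun m h1 h2 => absurd ⟨h1, h2⟩ hex
  filter_upwards [hev] with m hm a b ho
  rcases hhg a b ho with hid | ⟨hgo, -⟩ | ⟨c, d, hgo, hca, hbd⟩
  · left
    rcases hhf a b ho with hfid | ⟨hfo, -⟩ | ⟨p, q, hfo, hpa, hbq⟩
    · intro x hx hx'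
      refine commutator_smul_eq_of_fixed_left (hfid x hx hx') ?_
      rw [pow_inv_smul_of_smul_eq (hid x hx hx'), hfid x hx hx']
    · intro x hx hx'
      exact commutator_smul_eq_of_fixed_right (pow_smul_of_smul_eq (hid x hx hx') m)
        (pow_smul_of_smul_eq (hid _ (lt_smul_of_fixed hfo.inv.left hx)
          (smul_lt_of_fixed hfo.inv.right hx')) m)
    · obtain ⟨y, hy, hy'⟩ := exists_between ho.lt
      rcases hfg p q hfo with hgid | ⟨hgo, -⟩ | ⟨c, d, hgo, hcp, hqd⟩
      · intro x hx hx'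
        have hpx := hpa.trans hx
        have hxq := hx'.trans hbq
        exact commutator_smul_eq_of_fixed_right (pow_smul_of_smul_eq (hgid x hpx hxq) m)
          (pow_smul_of_smul_eq (hgid _ (lt_smul_of_fixed hfo.inv.left hpx)
            (smul_lt_of_fixed hfo.inv.right hxq)) m)
      · exact absurd (hid y hy hy') (hgo.ne y (hpa.trans hy) (hy'.trans hbq))
      · exact absurd (hid y hy hy') (hgo.ne y (hcp.trans (hpa.trans hy))
          ((hy'.trans hbq).trans hqd))
  · left
    rcases hhf a b ho with hfid | ⟨hfo, -⟩ | ⟨p, q, hfo, hpa, hbq⟩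
    · exact fun x hx hx' => commutator_smul_eq_of_fixed_left (hfid x hx hx')
        (hfid _ (lt_smul_of_fixed (pow_inv_smul_of_smul_eq hgo.left m) hx)
          (smul_lt_of_fixed (pow_inv_smul_of_smul_eq hgo.right m) hx'))
    · obtain ⟨y, hy, hy'⟩ := exists_between ho.lt
      rcases hfg.of_mem hfo hgo hy hy' hy hy' with h1 | h1
      · exact fun x hx hx' => h1.2.2.commutator_smul_eq hfo hgo m hx hx'
      · exact absurd h1.1 (lt_irrefl a)
    · exact (hfg.not_inside hfo hgo hpa hbq).elim
  · rcases hN.trichotomy hg hf hgo with hfh | hfo | ⟨p, q, hfo, hpc, hdq⟩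
    · obtain ⟨c', d', h1, h2, h3⟩ := hm (c, d) hgo hfh
        (hN.exists_hull hh hg hgo hca (ho.lt.trans hbd) ho.left)
      obtain ⟨y, hy, hy'⟩ := exists_between ho.lt
      obtain ⟨hc'a, hbd'⟩ := h2.orb_mem ho hy hy' (hca.trans hy) (hy'.trans hbd)
      have hef : ∀ x, a < x → x < b → ⁅f, g ^ m⁆ • x = f • x := fun x hx hx' =>
        h3 x (hc'a.trans hx.le) (hx'.le.trans hbd')
      rcases hhf a b ho with hfid | ⟨hfo, hcom⟩ | ⟨p, q, hfo, hpa, hbq⟩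
      · exact Or.inl fun x hx hx' => (hef x hx hx').trans (hfid x hx hx')
      · refine Or.inr (Or.inl ⟨hfo.congr fun x hx hx' => h3 x (hc'a.trans hx) (hx'.trans hbd'),
          fun x hx hx' => ?_⟩)
        rw [hef x hx hx', hef _ (lt_smul_of_fixed ho.left hx) (smul_lt_of_fixed ho.right hx'),
          hcom x hx hx']
      · obtain ⟨hc'p, hqd'⟩ := h1.orb_mem hfo (hpa.trans hy) (hy'.trans hbq) (hca.trans hy)
          (hy'.trans hbd)
        exact Or.inr (Or.inr ⟨p, q, c, d, hfo,
          hfo.congr fun x hx hx' => h3 x (hc'p.trans hx) (hx'.trans hqd'), hgo, hpa, hbq,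
          h1.lt_left.trans_le hc'p, hqd'.trans_lt h1.right_lt⟩)
    · left
      obtain ⟨y, hy, hy'⟩ := exists_between hgo.lt
      rcases hfg.of_mem hfo hgo hy hy' hy hy' with h1 | h1
      · exact fun x hx hx' =>
          h1.2.2.commutator_smul_eq hfo hgo m (hca.trans hx) (hx'.trans hbd)
      · exact absurd h1.1 (lt_irrefl c)
    · exact (hfg.not_inside hfo hgo hpc hdq).elim

theorem NestedIn.exists_of_not_commute {f g : PLoI} (h : NestedIn f g) (hc : ¬ Commute g f) :
    ∃ p q c d, IsOrb f p q ∧ IsOrb g c d ∧ c < p ∧ q < d := by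
  by_contra hcon
  refine hc (commute_of_moved fun x hx => ?_)
  obtain ⟨a, b, ha, hb, ho⟩ := exists_isOrb hx
  rcases h a b ho with h1 | ⟨h1, h2⟩ | ⟨c, d, h1, h2, h3⟩
  · rw [h1 x ha hb, h1 _ (lt_smul_of_fixed ho.left ha) (smul_lt_of_fixed ho.right hb),
      inv_smul_of_smul_eq (h1 x ha hb)]
    exact ⟨rfl, hx⟩
  · exact ⟨h2 x ha hb, ho.ne _ (lt_smul_of_fixed h1.inv.left ha)
      (smul_lt_of_fixed h1.inv.right hb)⟩
  · exact absurd ⟨a, b, c, d, ho, h1, h2, h3⟩ hcon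

/-! ### Carrying chains of nested orbitals through `φ` -/

/-- The intervals `(a i, b i)`, `i ≤ n`, are orbitals of the maps `F i`, each strictly inside the
next one. -/
structure NestedOrbs (n : ℕ) (F : ℕ → PLoI) (a b : ℕ → unitInterval) : Prop where
  isOrb : ∀ i ≤ n, IsOrb (F i) (a i) (b i)
  lt : ∀ i < n, a (i + 1) < a i ∧ b i < b (i + 1)

theorem NestedOrbs.extend {n : ℕ} {F : ℕ → PLoI} {a b : ℕ → unitInterval}
    (h : NestedOrbs n F a b) {c d : unitInterval} (ho : IsOrb (F (n + 1)) c d) (hc : c < a n)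
    (hd : b n < d) : ∃ a b, NestedOrbs (n + 1) F a b := by
  refine ⟨Function.update a (n + 1) c, Function.update b (n + 1) d, fun i hi => ?_, fun i hi => ?_⟩
  · rcases hi.eq_or_lt with rfl | hi
    · simpa using ho
    · rw [Function.update_of_ne hi.ne, Function.update_of_ne hi.ne]
      exact h.isOrb i (Nat.lt_succ_iff.1 hi)
  · rw [Function.update_of_ne hi.ne, Function.update_of_ne hi.ne]
    rcases (Nat.lt_succ_iff.1 hi).eq_or_lt with rfl | hi'
    · simpa using ⟨hc, hd⟩
    · rw [Function.update_of_ne (by omega), Function.update_of_ne (by omega)]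
      exact h.lt i hi'

theorem NestedOrbs.lt_of_lt {n : ℕ} {F : ℕ → PLoI} {a b : ℕ → unitInterval}
    (h : NestedOrbs n F a b) {i j : ℕ} (hij : i < j) (hj : j ≤ n) : a j < a i ∧ b i < b j := by
  induction j with
  | zero => omega
  | succ j ih =>
    have h1 := h.lt j (by omega)
    rcases (Nat.lt_succ_iff.1 hij).eq_or_lt with rfl | hlt
    · exact h1
    · have h2 := ih hlt (by omega)
      exact ⟨h1.1.trans h2.1, h2.2.trans h1.2⟩

/-- Induction on the number `n + 1` of maps, for all sequences at once, since the sequence changes: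
the top two maps are replaced by their commutator. -/
theorem exists_nestedOrbs_map {G H : Subgroup PLoI} (hG : Laminar G) (hH : Laminar H)
    {φ : G →* H} (hφ : Function.Injective φ) (n : ℕ) :
    ∀ F : ℕ → G, (∀ i j, i < j → j ≤ n → Subordinate (F i) (F j)) →
      (∃ a b, NestedOrbs n (fun i => F i) a b) → ∃ a b, NestedOrbs n (fun i => φ (F i)) a b := by
  have nestG : ∀ {f g : G}, Subordinate f g → NestedIn (f : PLoI) g := fun {f g} h =>
    hG.nestedIn_of_subordinate f.2 g.2 (h.map G.subtype)
  have nestH : ∀ {f g : G}, Subordinate f g → NestedIn (φ f : PLoI) (φ g) := fun {f g} h =>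
    hH.nestedIn_of_subordinate (φ f).2 (φ g).2 ((h.map φ).map H.subtype)
  induction n with
  | zero =>
    rintro F - ⟨a, b, h⟩
    have h0 := h.isOrb 0 le_rfl
    obtain ⟨x, hx, hx'⟩ := exists_between h0.lt
    have hne : (φ (F 0) : PLoI) ≠ 1 := fun he => h0.ne x hx hx' (by
      have : F 0 = 1 := hφ (by rw [map_one]; exact Subtype.ext he)
      simp [this])
    have : ∃ y : unitInterval, (φ (F 0) : PLoI) • y ≠ y := by
      by_contra! hc
      exact hne (ext_smul fun y => by rw [hc, one_smul])
    obtain ⟨y, hy⟩ := this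
    obtain ⟨p, q, -, -, ho⟩ := exists_isOrb hy
    refine ⟨fun _ => p, fun _ => q, fun i hi => ?_, fun i hi => absurd hi (Nat.not_lt_zero i)⟩
    rwa [Nat.le_zero.1 hi]
  | succ n ih =>
    rintro F hF ⟨a, b, h⟩
    have hfg := hF n (n + 1) (by omega) le_rfl
    have hif : ∀ i < n, Subordinate (F i) (F n) := fun i hi => hF i n hi (by omega)
    have hig : ∀ i < n, Subordinate (F i) (F (n + 1)) := fun i hi => hF i _ (by omega) le_rfl
    have evG := (eventually_all_finite (Set.finite_Iio n)).2 fun i (hi : i < n) =>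
      hG.eventually_commutator (F n).2 (F (n + 1)).2 (F i).2 (nestG (hif i hi))
        (nestG (hig i hi)) (nestG hfg)
    have evH := (eventually_all_finite (Set.finite_Iio n)).2 fun i (hi : i < n) =>
      hH.eventually_commutator (φ (F n)).2 (φ (F (n + 1))).2 (φ (F i)).2 (nestH (hif i hi))
        (nestH (hig i hi)) (nestH hfg)
    have hn := h.isOrb n (by omega)
    have hn1 := h.isOrb (n + 1) le_rfl
    have hlt := h.lt n (by omega)
    obtain ⟨c', d', hh⟩ := hG.exists_hull (F n).2 (F (n + 1)).2 hn1 hlt.1 (hn.lt.trans hlt.2)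
      hn.left
    -- A single exponent for both groups, so that `φ` sends the commutator analysed in `G` to the
    -- one analysed in `H`.
    obtain ⟨m, ⟨hmG, hmH⟩, hm⟩ := ((evG.and evH).and (hn1.eventually_commutator hh)).exists
    obtain ⟨y, hy, hy'⟩ := exists_between hn.lt
    obtain ⟨h1, h2⟩ := hh.orb_mem hn hy hy' (hlt.1.trans hy) (hy'.trans hlt.2)
    have heo : IsOrb ⁅(F n : PLoI), (F (n + 1) : PLoI) ^ m⁆ (a n) (b n) :=
      hn.congr fun x hx hx' => hm x (h1.trans hx) (hx'.trans h2)
    set e : G := ⁅F n, F (n + 1) ^ m⁆ with he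
    have hφe : (φ e : PLoI) = ⁅(φ (F n) : PLoI), (φ (F (n + 1)) : PLoI) ^ m⁆ := by
      rw [he, map_commutatorElement, map_pow]
      rfl
    have hsub : ∀ i < n, Subordinate (F i) e := by
      intro i hi
      refine Subordinate.of_map (φ := G.subtype) G.subtype_injective
        (hG.subordinate_of_nestedIn (F i).2 e.2 fun p q ho => ?_)
      rcases hmG i hi p q ho with h | h | ⟨r, s, c, d, -, h, -, h3, h4, -, -⟩
      · exact Or.inl h
      · exact Or.inr (Or.inl h)
      · exact Or.inr (Or.inr ⟨r, s, h, h3, h4⟩)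
    have hupd : ∀ i, i ≠ n → Function.update F n e i = F i := fun i hi =>
      Function.update_of_ne hi _ _
    have hupdn : Function.update F n e n = e := Function.update_self _ _ _
    obtain ⟨a', b', h'⟩ := ih (Function.update F n e) (fun i j hij hj => by
        rw [hupd i (by omega)]
        rcases hj.eq_or_lt with rfl | hj
        · rw [hupdn]
          exact hsub i hij
        · rw [hupd j hj.ne]
          exact hF i j hij (by omega)) ⟨a, b, fun i hi => by
        rcases hi.eq_or_lt with rfl | hi'
        · simp only [hupdn]
          exact heo
        · simp only [hupd i hi'.ne]
          exact h.isOrb i (by omega), fun i hi => h.lt i (by omega)⟩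
    have he' := h'.isOrb n le_rfl
    simp only [hupdn, hφe] at he'
    -- With no map below the commutator there is no orbital to locate inside it. Its image being
    -- nontrivial still shows that the two images do not commute, which suffices here.
    rcases Nat.eq_zero_or_pos n with rfl | hpos
    · obtain ⟨x, hx, hx'⟩ := exists_between he'.lt
      have hnc : ¬ Commute (φ (F (0 + 1)) : PLoI) (φ (F 0)) := fun hc => he'.ne x hx hx' (by
        rw [commutatorElement_eq_one_iff_commute.2 (hc.symm.pow_right m), one_smul])
      obtain ⟨p, q, c, d, hp, hc, hcp, hqd⟩ := (nestH hfg).exists_of_not_commute hnc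
      refine NestedOrbs.extend (a := fun _ => p) (b := fun _ => q) ⟨fun i hi => ?_,
        fun i hi => absurd hi (Nat.not_lt_zero i)⟩ hc hcp hqd
      rwa [Nat.le_zero.1 hi]
    · obtain ⟨k, rfl⟩ : ∃ k, n = k + 1 := ⟨n - 1, by omega⟩
      have hk := h'.isOrb k (by omega)
      simp only [hupd k (by omega)] at hk
      have hk1 := h'.lt k (by omega)
      obtain ⟨x, hx, hx'⟩ := exists_between hk.lt
      have hxa := hk1.1.trans hx
      have hxb := hx'.trans hk1.2
      -- The orbital of the image of `F k` lies strictly inside one of the image of `e`, which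
      -- excludes the first two alternatives; the third supplies the two top orbitals.
      rcases hmH k (Nat.lt_succ_self k) _ _ hk with h3 | ⟨h3, -⟩ |
        ⟨p, q, c, d, h3, h4, h5, h6, h7, h8, h9⟩
      · exact absurd (h3 x hx hx') (he'.ne x hxa hxb)
      · exact absurd (h3.eq_of_mem he' hx hx' hxa hxb).1 hk1.1.ne'
      · obtain ⟨rfl, rfl⟩ := h4.eq_of_mem he' (h6.trans hx) (hx'.trans h7) hxa hxb
        refine NestedOrbs.extend (n := k + 1) (a := a') (b := b')
          ⟨fun i hi => ?_, fun i hi => h'.lt i hi⟩ h5 h8 h9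
        rcases hi.eq_or_lt with rfl | hi'
        · exact h3
        · have := h'.isOrb i hi
          simp only [hupd i hi'.ne] at this
          exact this

end PLoI

/-! ### Signed orbitals through their endpoints -/

namespace SignedOrbital

open PLoI

/-- The left endpoint of a signed orbital. -/
noncomputable def leftEnd (p : SignedOrbital) : unitInterval := sInf p.orbital

/-- The right endpoint of a signed orbital. -/
noncomputable def rightEnd (p : SignedOrbital) : unitInterval := sSup p.orbital

theorem isOrb_and_eq_Ioo (p : SignedOrbital) :
    IsOrb p.signature p.leftEnd p.rightEnd ∧ p.orbital = Set.Ioo p.leftEnd p.rightEnd := by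
  obtain ⟨a, b, h, hp⟩ := exists_eq_Ioo p.isOrbital
  have h1 : p.leftEnd = a := by rw [leftEnd, hp, csInf_Ioo h.lt]
  have h2 : p.rightEnd = b := by rw [rightEnd, hp, csSup_Ioo h.lt]
  rw [h1, h2]
  exact ⟨h, hp⟩

theorem isOrb (p : SignedOrbital) : IsOrb p.signature p.leftEnd p.rightEnd := p.isOrb_and_eq_Ioo.1

/-- The signed orbital with given endpoints. -/
def ofIsOrb {f : PLoI} {a b : unitInterval} (h : IsOrb f a b) : SignedOrbital :=
  ⟨Set.Ioo a b, f, isOrbital_Ioo h⟩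

theorem lt_of_ends {p q : SignedOrbital} (hl : q.leftEnd < p.leftEnd)
    (hr : p.rightEnd < q.rightEnd) : p < q := by
  have hss : p.orbital ⊂ q.orbital := by
    rw [p.isOrb_and_eq_Ioo.2, q.isOrb_and_eq_Ioo.2]
    exact ⟨Set.Ioo_subset_Ioo hl.le hr.le,
      fun h => lt_irrefl _ (h ⟨hl, p.isOrb.lt.trans hr⟩).1⟩
  exact lt_of_le_of_ne (Or.inl hss) fun h => hss.ne (h ▸ rfl)

theorem ends_lt_of_lt {N : Subgroup PLoI} (hN : Laminar N) {p q : SignedOrbital}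
    (hp : p.signature ∈ N) (hq : q.signature ∈ N) (h : p < q) :
    q.leftEnd < p.leftEnd ∧ p.rightEnd < q.rightEnd := by
  have hss : p.orbital ⊂ q.orbital := by
    rcases h.le with h1 | ⟨h1, h2⟩
    · exact h1
    · exact absurd (SignedOrbital.ext h1 h2) h.ne
  obtain ⟨hpo, hpe⟩ := p.isOrb_and_eq_Ioo
  obtain ⟨hqo, hqe⟩ := q.isOrb_and_eq_Ioo
  obtain ⟨x, hx, hx'⟩ := exists_between hpo.lt
  have hxq : x ∈ q.orbital := hss.1 (by rw [hpe]; exact ⟨hx, hx'⟩)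
  rw [hqe] at hxq
  rcases hN _ hp _ hq _ _ _ _ x hpo hqo hx hx' hxq.1 hxq.2 with h1 | h1 | h1
  · exact absurd (by rw [hpe, hqe, h1.1, h1.2]) hss.ne
  · exact h1
  · exact (lt_asymm h (lt_of_ends h1.1 h1.2)).elim

end SignedOrbital

/-! ### Towers as increasing sequences, and the induced map -/

namespace PLoI

theorem rightEndpoints_eq (T : Set SignedOrbital) :
    rightEndpoints T = SignedOrbital.rightEnd '' T := by
  ext r
  constructor
  · rintro ⟨p, hp, h⟩
    exact ⟨p, hp, (isLUB_sSup _).unique h⟩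
  · rintro ⟨p, hp, rfl⟩
    exact ⟨p, hp, isLUB_sSup _⟩

theorem IsPure.isUntwisted {T : Set SignedOrbital} (h : IsPure T) : IsUntwisted T := by
  intro p hp q hq A B hA hB _ C D hC hD _
  obtain rfl := (h _ ⟨p, hp, rfl⟩).unique hA hC
  obtain rfl := (h _ ⟨q, hq, rfl⟩).unique hB hD
  exact ⟨id, id, id⟩

theorem signature_eq_of_inducedMap {G H : Subgroup PLoI} (φ : G →* H) {T : Set SignedOrbital}
    (hT : T ⊆ signedOrbitals (G : Set PLoI)) {S : Set SignedOrbital} {p : T} {s : S}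
    (h : inducedMap φ hT S p = some s) :
    (s : SignedOrbital).signature = φ ⟨(p : SignedOrbital).signature, hT p.2⟩ := by
  unfold inducedMap at h
  split_ifs at h with hex
  rw [← Option.some.inj h]
  exact hex.choose_spec

theorem inducedMap_eq_some {G H : Subgroup PLoI} (φ : G →* H) {T : Set SignedOrbital}
    (hT : T ⊆ signedOrbitals (G : Set PLoI)) {S : Set SignedOrbital} {p : T} {s : S}
    (hs : (s : SignedOrbital).signature = φ ⟨(p : SignedOrbital).signature, hT p.2⟩)
    (huniq : ∀ t : S, (t : SignedOrbital).signature = (s : SignedOrbital).signature → t = s) :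
    inducedMap φ hT S p = some s := by
  have hex : ∃ s : S, (s : SignedOrbital).signature =
      ((φ ⟨(p : SignedOrbital).signature, hT p.2⟩ : H) : PLoI) := ⟨s, hs⟩
  unfold inducedMap
  rw [dif_pos hex]
  exact congrArg some (huniq _ (hex.choose_spec.trans hs.symm))

/-- A tower of type `n` in a group with nested orbitals is a strictly increasing sequence of
length `n`. -/
theorem exists_enumeration {N : Subgroup PLoI} (hN : Laminar N) {n : ℕ} {T : Set SignedOrbital}
    (hT : IsNTowerIn (signedOrbitals (N : Set PLoI)) n T) :
    ∃ t : Fin n → SignedOrbital, StrictMono t ∧ Set.range t = T := by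
  obtain ⟨⟨hTN, hchain⟩, ⟨e⟩⟩ := hT
  rw [rightEndpoints_eq] at e
  -- Strict nesting moves both ends, so right endpoints distinguish and order the elements of the
  -- tower.
  have hr : ∀ p ∈ T, ∀ q ∈ T, p.rightEnd < q.rightEnd → p < q := by
    intro p hp q hq h
    rcases eq_or_ne p q with rfl | hne
    · exact absurd h (lt_irrefl _)
    rcases hchain hp hq hne with h1 | h1
    · exact lt_of_le_of_ne h1 hne
    · exact absurd h (SignedOrbital.ends_lt_of_lt hN (hTN hq) (hTN hp)
        (lt_of_le_of_ne h1 hne.symm)).2.not_gt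
  choose t ht using fun i : Fin n => (e.symm i).2
  refine ⟨t, fun i j hij => hr _ (ht i).1 _ (ht j).1 ?_, ?_⟩
  · rw [(ht i).2, (ht j).2]
    exact e.symm.strictMono hij
  · refine Set.Subset.antisymm (Set.range_subset_iff.2 fun i => (ht i).1) fun p hp => ?_
    refine ⟨e ⟨p.rightEnd, p, hp, rfl⟩, ?_⟩
    have h := ht (e ⟨p.rightEnd, p, hp, rfl⟩)
    rw [OrderIso.symm_apply_apply] at h
    by_contra hne
    rcases hchain h.1 hp hne with h1 | h1
    · exact (SignedOrbital.ends_lt_of_lt hN (hTN h.1) (hTN hp)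
        (lt_of_le_of_ne h1 hne)).2.ne h.2
    · exact (SignedOrbital.ends_lt_of_lt hN (hTN hp) (hTN h.1)
        (lt_of_le_of_ne h1 (Ne.symm hne))).2.ne' h.2

theorem subordinate_of_lt {N : Subgroup PLoI} (hN : Laminar N) {T : Set SignedOrbital}
    (hTN : T ⊆ signedOrbitals (N : Set PLoI)) (hu : IsUntwisted T) {p q : SignedOrbital}
    (hp : p ∈ T) (hq : q ∈ T) (h : p < q) :
    Subordinate (⟨p.signature, hTN hp⟩ : N) ⟨q.signature, hTN hq⟩ := by
  obtain ⟨h1, h2⟩ := SignedOrbital.ends_lt_of_lt hN (hTN hp) (hTN hq) h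
  exact Subordinate.of_map (φ := N.subtype) N.subtype_injective
    (hN.subordinate_of_nestedIn (hTN hp) (hTN hq)
      (hN.nestedIn_of_isUntwistedPair (hTN hp) (hTN hq) (hu p hp q hq) p.isOrb q.isOrb h1 h2))

theorem exists_image_sequence {G H : Subgroup PLoI} (hG : Laminar G) (hH : Laminar H)
    {φ : G →* H} (hφ : Function.Injective φ) {n : ℕ} {T : Set SignedOrbital}
    (hTG : T ⊆ signedOrbitals (G : Set PLoI)) (hu : IsUntwisted T) {t : Fin n → SignedOrbital}
    (ht : StrictMono t) (htT : ∀ i, t i ∈ T) :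
    ∃ s : Fin n → SignedOrbital, StrictMono s ∧
      ∀ i, (s i).signature = φ ⟨(t i).signature, hTG (htT i)⟩ := by
  rcases n with _ | k
  · exact ⟨fun i => i.elim0, fun i => i.elim0, fun i => i.elim0⟩
  -- Indices beyond `k` repeat the last element, turning the finite sequence into one on `ℕ`.
  let u : ℕ → Fin (k + 1) := fun i => ⟨min i k, by omega⟩
  have huv : ∀ {i}, i ≤ k → (u i : ℕ) = i := fun {i} hi => min_eq_left hi
  have hui : ∀ i : Fin (k + 1), u i = i := fun i => Fin.ext (huv (Nat.lt_succ_iff.1 i.2))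
  have hlt : ∀ {i j}, i < j → j ≤ k → u i < u j := fun {i j} hij hj => by
    rw [Fin.lt_def, huv (by omega), huv hj]
    exact hij
  let F : ℕ → G := fun i => ⟨(t (u i)).signature, hTG (htT _)⟩
  obtain ⟨a, b, hab⟩ := exists_nestedOrbs_map hG hH hφ k F
    (fun i j hij hj => subordinate_of_lt hG hTG hu (htT _) (htT _) (ht (hlt hij hj)))
    ⟨fun i => (t (u i)).leftEnd, fun i => (t (u i)).rightEnd, fun i _ => (t (u i)).isOrb,
      fun i hi => SignedOrbital.ends_lt_of_lt hG (hTG (htT _)) (hTG (htT _))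
        (ht (hlt (Nat.lt_succ_self i) hi))⟩
  have ho : ∀ i : Fin (k + 1), IsOrb (φ (F i) : PLoI) (a i) (b i) := fun i =>
    hab.isOrb i (Nat.lt_succ_iff.1 i.2)
  refine ⟨fun i => SignedOrbital.ofIsOrb (ho i), fun i j hij => ?_, fun i => ?_⟩
  · have h := hab.lt_of_lt (i := i) (j := j) hij (Nat.lt_succ_iff.1 j.2)
    refine SignedOrbital.lt_of_ends ?_ ?_
    · change sInf (Set.Ioo _ _) < sInf (Set.Ioo _ _)
      rw [csInf_Ioo (ho i).lt, csInf_Ioo (ho j).lt]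
      exact h.1
    · change sSup (Set.Ioo _ _) < sSup (Set.Ioo _ _)
      rw [csSup_Ioo (ho i).lt, csSup_Ioo (ho j).lt]
      exact h.2
  · change (φ (F i) : PLoI) = _
    simp only [F, hui]

end PLoI

open PLoI in
theorem mainTheorem9 (G H : Subgroup PLoI) (hG : Group.IsSolvable G) (hH : Group.IsSolvable H)
    (φ : G →* H) (hφ : Function.Injective φ) (n : ℕ) (T : Set SignedOrbital)
    (hT : IsNTowerIn (signedOrbitals (G : Set PLoI)) n T) (hPU : IsPure T ∨ IsUntwisted T) :
    (∃ S : Set SignedOrbital, IsNTowerIn (imageSignedOrbitals φ T) n S) ∧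
    (∀ U : Set SignedOrbital, IsTowerIn (imageSignedOrbitals φ T) U →
      IsNondecreasingOffEmpty (inducedMap φ hT.1.1 U)) ∧
    (∃ S : Set SignedOrbital, IsTowerIn (imageSignedOrbitals φ T) S ∧
      IsOrderIsomorphism (inducedMap φ hT.1.1 S)) := by
  have hGL := laminar_of_isSolvable G hG
  have hHL := laminar_of_isSolvable H hH
  have hu : IsUntwisted T := hPU.elim IsPure.isUntwisted id
  have hTG := hT.1.1
  obtain ⟨t, ht, htT⟩ := exists_enumeration hGL hT
  have htm : ∀ i, t i ∈ T := fun i => htT ▸ Set.mem_range_self i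
  obtain ⟨s, hs, hst⟩ := exists_image_sequence hGL hHL hφ hTG hu ht htm
  have hsH : ∀ i, (s i).signature ∈ H := fun i => by
    rw [hst]
    exact (φ _).2
  have hS : IsTowerIn (imageSignedOrbitals φ T) (Set.range s) := by
    refine ⟨?_, hs.monotone.isChain_range⟩
    rintro _ ⟨i, rfl⟩
    exact ⟨⟨(t i).signature, hTG (htm i)⟩, ⟨t i, htm i, rfl⟩, (hst i).symm⟩
  refine ⟨⟨Set.range s, hS, ?_⟩, ?_, Set.range s, hS, ?_⟩
  · have hr : StrictMono fun i => (s i).rightEnd := fun i j hij =>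
      (SignedOrbital.ends_lt_of_lt hHL (hsH i) (hsH j) (hs hij)).2
    have he : rightEndpoints (Set.range s) = Set.range fun i => (s i).rightEnd := by
      rw [rightEndpoints_eq, ← Set.range_comp]
      rfl
    rw [he]
    exact ⟨hr.orderIso.symm⟩
  · intro U hU p q hpq x y hx hy
    have hxs := signature_eq_of_inducedMap φ _ hx
    have hys := signature_eq_of_inducedMap φ _ hy
    rcases hpq.eq_or_lt with rfl | hlt
    · exact (Option.some.inj (hx.symm.trans hy)).le
    rcases hU.2.total x.2 y.2 with h | h
    · exact h
    rcases h.eq_or_lt with h | h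
    · exact h.ge
    have hxH : (x : SignedOrbital).signature ∈ H := hxs ▸ (φ _).2
    have hyH : (y : SignedOrbital).signature ∈ H := hys ▸ (φ _).2
    -- If the order were reversed, an orbital of the image of the smaller signature would strictly
    -- contain one of the larger, against subordination.
    obtain ⟨h1, h2⟩ := SignedOrbital.ends_lt_of_lt hHL hyH hxH h
    have hsub := ((subordinate_of_lt hGL hTG hu p.2 q.2 hlt).map φ).map H.subtype
    have hn := hHL.nestedIn_of_subordinate (φ _).2 (φ _).2 hsub
    have hxo := (x : SignedOrbital).isOrb
    have hyo := (y : SignedOrbital).isOrb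
    rw [hxs] at hxo
    rw [hys] at hyo
    exact (hn.not_inside hxo hyo h1 h2).elim
  · have hinj : ∀ i j, (s i).signature = (s j).signature → i = j := by
      have key : ∀ i j, i < j → (s i).signature ≠ (s j).signature := by
        intro i j hij he
        obtain ⟨h1, h2⟩ := SignedOrbital.ends_lt_of_lt hHL (hsH i) (hsH j) (hs hij)
        refine (s j).isOrb.ne _ h1 ((s i).isOrb.lt.trans h2) ?_
        rw [← he]
        exact (s i).isOrb.left
      intro i j he
      rcases lt_trichotomy i j with h | h | h
      · exact absurd he (key i j h)
      · exact h
      · exact absurd he.symm (key j i h)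
    let E : Fin n ≃o T := (ht.orderIso t).trans (OrderIso.setCongr _ _ htT)
    refine ⟨E.symm.trans (hs.orderIso s), fun p => ?_⟩
    obtain ⟨i, rfl⟩ := E.surjective p
    have hE : (E.symm.trans (hs.orderIso s)) (E i) = hs.orderIso s i :=
      congrArg (hs.orderIso s) (E.symm_apply_apply i)
    refine (inducedMap_eq_some φ hTG (hst i) ?_).trans (congrArg some hE.symm)
    rintro ⟨_, j, rfl⟩ h
    obtain rfl := hinj j i h
    rfl
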